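/- **Setting.** Place $q_k<\infty$ qubits at every site $k$ of the lattice $\mathbb Z$ (the $q_k$ are arbitrary). Let $\mathcal P$ be the group of finitely supported Pauli operators modulo phase factors, an $\mathbb F_2$-vector space; whether two elements commute is well defined. An operator is $\ell$-local if its support lies in an interval of diameter $\ell$. A *stabilizer group* is a subgroup $\mathcal A\subseteq\mathcal P$ all of whose elements commute (as operators); $\mathcal A^\perp$ is the group of all elements of $\mathcal P$ that commute with $\mathcal A$ (its finitely supported logical operators). A pair $(\mathcal A,\mathcal B)$ of stabilizer groups is *locally reversible* if, for some $\ell$, there are sets $\{A_i\}\subseteq\mathcal A$ and $\{B_j\}\subseteq\mathcal B$ of $\ell$-local operators which together with $\mathcal A\cap\mathcal B$ generate $\mathcal A$ and $\mathcal B$ respectively, such that for each $A_{i'}$ some $B_{j'}$ commutes with every $A_i$ except $A_{i'}$, and for each $B_{j'}$ some $A_{i'}$ commutes with every $B_j$ except $B_{j'}$. For such a pair there is an isomorphism $\mathcal A^\perp/\mathcal A\to\mathcal B^\perp/\mathcal B$ that sends the class of each $P\in\mathcal A^\perp\cap\mathcal B^\perp$ to the class of the same $P$. A *one-dimensional periodic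 locally reversible measurement circuit* (PLRMC) is a finite sequence $\mathcal A_0\to\mathcal A_1\to\dots\to\mathcal A_T=\mathcal A_0$ of stabilizer groups whose consecutive pairs are locally reversible and whose base group $\mathcal A_0$ is generated by $\ell$-local operators for some $\ell$. Its *canonical MQCA* is the automorphism of $\mathcal L/\mathcal S$, with $\mathcal L=\mathcal A_0^\perp$ and $\mathcal S=\mathcal A_0$, obtained by composing the $T$ isomorphisms above. In general, for subgroups $\mathcal S\subseteq\mathcal L\subseteq\mathcal P$, an *MQCA* is an automorphism $\alpha$ of $\mathcal L/\mathcal S$ for which there is an $r$ such that for every $P\in\mathcal L$ the class $\alpha([P])$ has a representative in $\mathcal L$ supported on the $r$-neighborhood of the support of $P$. **Index.** For $R\subseteq\mathbb Z$ let $\mathcal L^{/\mathcal S}_R$ be the group of the elements of $\mathcal L/\mathcal S$ that have a representative in $\mathcal L$ supported on $R$, and put $\mathcal L^{/\mathcal S}_{+\infty}=\bigcap_k\mathcal L^{/\mathcal S}_{(k,\infty)}$, $\mathcal L^{/\mathcal S}_{-\infty}=\bigcap_k\mathcal L^{/\mathcal S}_{(-\infty,k)}$, $\mathcal F=(\mathcal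 L/\mathcal S)/(\mathcal L^{/\mathcal S}_{-\infty}+\mathcal L^{/\mathcal S}_{+\infty})$ and $\mathcal F_{<a}=(\mathcal L^{/\mathcal S}_{(-\infty,a)}+\mathcal L^{/\mathcal S}_{+\infty})/(\mathcal L^{/\mathcal S}_{-\infty}+\mathcal L^{/\mathcal S}_{+\infty})$. An MQCA $\alpha$ induces a linear map $\bar\alpha:\mathcal F\to\mathcal F$. We say that $\alpha$ has *MQCA index* $x$, written $\operatorname{Ind}(\alpha)=x$, if for all sites $a\le b$, all subspaces $\mathcal F_{<a}\subseteq\mathcal F_\circ\subseteq\mathcal F_{<b}$ and all linear projections $\nu:\mathcal F\to\mathcal F_\circ$ the map $\phi=\nu\bar\alpha|_{\mathcal F_\circ}:\mathcal F_\circ\to\mathcal F_\circ$ is Fredholm (finite-dimensional kernel and cokernel) and $\tfrac12(\dim\ker\phi-\dim\operatorname{coker}\phi)=x$. **Theorem.** The canonical MQCA of every one-dimensional PLRMC has an MQCA index, and this index is an integer. In contrast, let $\mathcal L$ be the Majorana chain algebra generated by $L_j=X_jZ_{j+1}$, $j\in\mathbb Z$, on the chain with one qubit per site, and let $\mathcal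 S$ be trivial. Then there is an MQCA $\alpha$ of $\mathcal L/\mathcal S$ with $\alpha(L_j)=L_{j+1}$ for all $j$, and $\operatorname{Ind}(\alpha)=\tfrac12$. -/

import Mathlib

noncomputable section

/-! ## Pauli operators on a one-dimensional lattice of qubits -/

/-- Finitely supported Pauli operators, modulo phase factors, on the lattice `ℤ` with `q k` qubits
at the site `k`.  The value `(x, z)` at a qubit stands for the tensor factor `X ^ x * Z ^ z`, and
the product of operators is written additively. -/
def Pauli (q : ℤ → ℕ) : Type := (Σ k : ℤ, Fin (q k)) →₀ (ZMod 2 × ZMod 2)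

namespace Pauli

variable {q : ℤ → ℕ}

instance : AddCommGroup (Pauli q) :=
  inferInstanceAs (AddCommGroup ((Σ k : ℤ, Fin (q k)) →₀ (ZMod 2 × ZMod 2)))

instance : Module (ZMod 2) (Pauli q) :=
  inferInstanceAs (Module (ZMod 2) ((Σ k : ℤ, Fin (q k)) →₀ (ZMod 2 × ZMod 2)))

instance : FunLike (Pauli q) (Σ k : ℤ, Fin (q k)) (ZMod 2 × ZMod 2) :=
  inferInstanceAs (FunLike ((Σ k : ℤ, Fin (q k)) →₀ (ZMod 2 × ZMod 2)) _ _)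

/-- The finite set of qubits on which a Pauli operator acts nontrivially. -/
def support (P : Pauli q) : Finset (Σ k : ℤ, Fin (q k)) := Finsupp.support P

/-- The Pauli operator with tensor factor `p` at the qubit `i` and no other factor. -/
def single (i : Σ k : ℤ, Fin (q k)) (p : ZMod 2 × ZMod 2) : Pauli q := Finsupp.single i p

theorem mem_support {P : Pauli q} {i : Σ k : ℤ, Fin (q k)} : i ∈ P.support ↔ P i ≠ 0 :=
  Finsupp.mem_support_iff

@[ext] theorem ext {P Q : Pauli q} (h : ∀ i, P i = Q i) : P = Q := Finsupp.ext h

@[simp] theorem zero_apply (i : Σ k : ℤ, Fin (q k)) : (0 : Pauli q) i = 0 := rfl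

@[simp] theorem add_apply (P Q : Pauli q) (i : Σ k : ℤ, Fin (q k)) : (P + Q) i = P i + Q i := rfl

@[simp] theorem smul_apply (c : ZMod 2) (P : Pauli q) (i : Σ k : ℤ, Fin (q k)) :
    (c • P) i = c • P i := rfl

end Pauli

/-- The commutation form as a function: the sum over all qubits of the commutation signs of the
tensor factors, where `X ^ x * Z ^ z` and `X ^ x' * Z ^ z'` commute up to `(-1) ^ (x z' + z x')`. -/
def commFun (q : ℤ → ℕ) (P Q : Pauli q) : ZMod 2 :=
  ∑ i ∈ P.support, ((P i).1 * (Q i).2 + (P i).2 * (Q i).1)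

theorem commFun_eq {q : ℤ → ℕ} {P Q : Pauli q} {s : Finset (Σ k : ℤ, Fin (q k))}
    (hs : P.support ⊆ s) : commFun q P Q = ∑ i ∈ s, ((P i).1 * (Q i).2 + (P i).2 * (Q i).1) := by
  refine Finset.sum_subset hs fun i _ hi => ?_
  have h0 : P i = 0 := by
    by_contra h
    exact hi (Pauli.mem_support.2 h)
  simp [h0]

/-- The commutation form: `commForm q P Q = 0` if the Pauli operators `P` and `Q` commute, and
`commForm q P Q = 1` if they anticommute. -/
def commForm (q : ℤ → ℕ) : Pauli q →ₗ[ZMod 2] Pauli q →ₗ[ZMod 2] ZMod 2 :=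
  LinearMap.mk₂ (ZMod 2) (commFun q)
    (fun P P' Q => by
      classical
      have h1 : P.support ⊆ (P + P').support ∪ (P.support ∪ P'.support) := by grind
      have h2 : P'.support ⊆ (P + P').support ∪ (P.support ∪ P'.support) := by grind
      rw [commFun_eq h1, commFun_eq h2, commFun_eq Finset.subset_union_left,
        ← Finset.sum_add_distrib]
      refine Finset.sum_congr rfl fun i _ => ?_
      simp only [Pauli.add_apply, Prod.fst_add, Prod.snd_add]
      ring)
    (fun c P Q => by
      classical
      rw [commFun_eq (Finset.subset_union_left (s₂ := P.support)),
        commFun_eq (P := P) (Finset.subset_union_right (s₁ := (c • P).support)), smul_eq_mul,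
        Finset.mul_sum]
      refine Finset.sum_congr rfl fun i _ => ?_
      simp only [Pauli.smul_apply, Prod.smul_fst, Prod.smul_snd, smul_eq_mul]
      ring)
    (fun P Q Q' => by
      simp only [commFun, ← Finset.sum_add_distrib, Pauli.add_apply, Prod.fst_add, Prod.snd_add]
      exact Finset.sum_congr rfl fun i _ => by ring)
    (fun c P Q => by
      simp only [commFun, Pauli.smul_apply, Prod.smul_fst, Prod.smul_snd, smul_eq_mul,
        Finset.mul_sum]
      exact Finset.sum_congr rfl fun i _ => by ring)

variable {q : ℤ → ℕ}

/-- The set of sites on which a Pauli operator acts nontrivially. -/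
def siteSupport (P : Pauli q) : Set ℤ := {k | ∃ i : Fin (q k), P ⟨k, i⟩ ≠ 0}

/-- The group of the Pauli operators that are supported on a region `R`. -/
def pauliOn (q : ℤ → ℕ) (R : Set ℤ) : Submodule (ZMod 2) (Pauli q) where
  carrier := {P | siteSupport P ⊆ R}
  zero_mem' := by rintro k ⟨i, hi⟩; simp at hi
  add_mem' := by
    rintro P Q hP hQ k ⟨i, hi⟩
    by_cases h : P ⟨k, i⟩ = 0
    · exact hQ ⟨i, fun h' => hi (by simp [h, h'])⟩
    · exact hP ⟨i, h⟩
  smul_mem' := by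
    rintro c P hP k ⟨i, hi⟩
    exact hP ⟨i, fun h => hi (by simp [h])⟩

/-- The set of all sites within distance `r` of a region `R`. -/
def nbhd (r : ℕ) (R : Set ℤ) : Set ℤ := {k | ∃ j ∈ R, |k - j| ≤ r}

/-- An operator is `ℓ`-local if its support lies in an interval of diameter `ℓ`. -/
def IsLocal (ℓ : ℕ) (P : Pauli q) : Prop := ∃ k : ℤ, siteSupport P ⊆ Set.Icc k (k + ℓ)

/-! ## Stabilizer groups and locally reversible pairs -/

/-- A Pauli stabilizer group (signs ignored): an abelian group of finitely supported Pauli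
operators. -/
structure StabilizerGroup (q : ℤ → ℕ) where
  group : Submodule (ZMod 2) (Pauli q)
  abelian : ∀ P ∈ group, ∀ Q ∈ group, commForm q P Q = 0

/-- The group is generated by `ℓ`-local operators, for some `ℓ`. -/
def StabilizerGroup.LocallyGenerated (A : StabilizerGroup q) : Prop :=
  ∃ (ℓ : ℕ) (G : Set (Pauli q)), (∀ g ∈ G, IsLocal ℓ g) ∧ Submodule.span (ZMod 2) G = A.group

/-- The group of all finitely supported logical operators: the Pauli operators that commute with
every stabilizer. -/
def StabilizerGroup.logicals (A : StabilizerGroup q) : Submodule (ZMod 2) (Pauli q) where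
  carrier := {P | ∀ a ∈ A.group, commForm q P a = 0}
  zero_mem' := by intro a _; simp
  add_mem' := by intro P Q hP hQ a ha; simp [hP a ha, hQ a ha]
  smul_mem' := by intro c P hP a ha; simp [hP a ha]

/-- Local reversibility of a pair of stabilizer groups: there are `ℓ`-local sets `GA ⊆ A` and
`GB ⊆ B` which generate `A` and `B` above `A ∩ B`, such that for each `a ∈ GA` some `b ∈ GB`
commutes with all elements of `GA` but `a`, and for each `b ∈ GB` some `a ∈ GA` commutes with all
elements of `GB` but `b`. -/
def LocallyReversible (A B : StabilizerGroup q) : Prop :=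
  ∃ (ℓ : ℕ) (GA GB : Set (Pauli q)),
    (∀ a ∈ GA, IsLocal ℓ a) ∧ (∀ b ∈ GB, IsLocal ℓ b) ∧
    Submodule.span (ZMod 2) GA ⊔ (A.group ⊓ B.group) = A.group ∧
    Submodule.span (ZMod 2) GB ⊔ (A.group ⊓ B.group) = B.group ∧
    (∀ a ∈ GA, ∃ b ∈ GB, ∀ a' ∈ GA, commForm q a' b = 0 ↔ a' ≠ a) ∧
    (∀ b ∈ GB, ∃ a ∈ GA, ∀ b' ∈ GB, commForm q a b' = 0 ↔ b' ≠ b)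

/-! ## Measurement quantum cellular automata -/

/-- The quotient group `L / S`. -/
abbrev LogicalQuot (L S : Submodule (ZMod 2) (Pauli q)) : Type := L ⧸ S.submoduleOf L

/-- The class in `L / S` of an element of `L`. -/
def cls {L : Submodule (ZMod 2) (Pauli q)} (S : Submodule (ZMod 2) (Pauli q)) (P : L) :
    LogicalQuot L S := (S.submoduleOf L).mkQ P

/-- A measurement quantum cellular automaton: an automorphism of `L / S` for which there is a
constant `r` such that the image of the class of any `P` is represented by an operator that is
supported on the `r`-neighborhood of the support of `P`. -/
structure MQCA (L S : Submodule (ZMod 2) (Pauli q)) where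
  toEquiv : LogicalQuot L S ≃ₗ[ZMod 2] LogicalQuot L S
  finite_range : ∃ r : ℕ, ∀ P : L, ∃ Q : L,
    toEquiv (cls S P) = cls S Q ∧ siteSupport Q.1 ⊆ nbhd r (siteSupport P.1)

section Index

variable (L S : Submodule (ZMod 2) (Pauli q))

/-- The elements of `L / S` that have a representative supported on `R`. -/
def quotOn (R : Set ℤ) : Submodule (ZMod 2) (LogicalQuot L S) :=
  ((pauliOn q R).submoduleOf L).map (S.submoduleOf L).mkQ

/-- The elements of `L / S` that have representatives arbitrarily far to the right. -/
def quotPosInf : Submodule (ZMod 2) (LogicalQuot L S) := ⨅ k : ℤ, quotOn L S (Set.Ioi k)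

/-- The elements of `L / S` that have representatives arbitrarily far to the left. -/
def quotNegInf : Submodule (ZMod 2) (LogicalQuot L S) := ⨅ k : ℤ, quotOn L S (Set.Iio k)

/-- The quotient `F` of `L / S` by the product of the two groups at infinity. -/
abbrev FSpace : Type := LogicalQuot L S ⧸ (quotNegInf L S ⊔ quotPosInf L S)

/-- The subgroup `F_{<a}` of `F`. -/
def FLeft (a : ℤ) : Submodule (ZMod 2) (FSpace L S) :=
  (quotOn L S (Set.Iio a) ⊔ quotPosInf L S).map (quotNegInf L S ⊔ quotPosInf L S).mkQ

variable {L S}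

theorem mem_quotOn {R : Set ℤ} {x : LogicalQuot L S} :
    x ∈ quotOn L S R ↔ ∃ P : L, siteSupport P.1 ⊆ R ∧ cls S P = x := by
  simp only [quotOn, Submodule.mem_map]
  rfl

theorem MQCA.map_infinity (α : MQCA L S) :
    quotNegInf L S ⊔ quotPosInf L S ≤
      (quotNegInf L S ⊔ quotPosInf L S).comap (α.toEquiv : LogicalQuot L S →ₗ[ZMod 2] _) := by
  obtain ⟨r, hr⟩ := α.finite_range
  rw [sup_le_iff]
  constructor
  · intro x hx
    refine Submodule.mem_sup_left ((Submodule.mem_iInf _).2 fun k => ?_)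
    obtain ⟨P, hP, rfl⟩ := mem_quotOn.1 ((Submodule.mem_iInf _).1 hx (k - r))
    obtain ⟨Q, hQ, hs⟩ := hr P
    refine mem_quotOn.2 ⟨Q, fun m hm => ?_, hQ.symm⟩
    obtain ⟨j, hj, hmj⟩ := hs hm
    have h1 := hP hj
    have h2 := abs_le.1 hmj
    simp only [Set.mem_Iio] at h1 ⊢
    omega
  · intro x hx
    refine Submodule.mem_sup_right ((Submodule.mem_iInf _).2 fun k => ?_)
    obtain ⟨P, hP, rfl⟩ := mem_quotOn.1 ((Submodule.mem_iInf _).1 hx (k + r))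
    obtain ⟨Q, hQ, hs⟩ := hr P
    refine mem_quotOn.2 ⟨Q, fun m hm => ?_, hQ.symm⟩
    obtain ⟨j, hj, hmj⟩ := hs hm
    have h1 := hP hj
    have h2 := abs_le.1 hmj
    simp only [Set.mem_Ioi] at h1 ⊢
    omega

/-- The map that an MQCA induces on `F`. -/
def MQCA.bar (α : MQCA L S) : FSpace L S →ₗ[ZMod 2] FSpace L S :=
  Submodule.mapQ _ _ (α.toEquiv : LogicalQuot L S →ₗ[ZMod 2] _) α.map_infinity

/-- The compression `ν ∘ bar α ∘ ι` of the induced map to a subgroup `F₀` of `F`, where `ι` is the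
inclusion of `F₀`. -/
def MQCA.compression (α : MQCA L S) (F₀ : Submodule (ZMod 2) (FSpace L S))
    (ν : FSpace L S →ₗ[ZMod 2] F₀) : F₀ →ₗ[ZMod 2] F₀ :=
  ν ∘ₗ α.bar ∘ₗ F₀.subtype

end Index

/-- A linear map is Fredholm if its kernel and its cokernel are finite-dimensional. -/
def IsFredholm {K V W : Type} [Field K] [AddCommGroup V] [Module K V] [AddCommGroup W]
    [Module K W] (φ : V →ₗ[K] W) : Prop :=
  Module.Finite K (LinearMap.ker φ) ∧ Module.Finite K (W ⧸ LinearMap.range φ)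

/-- The index of a Fredholm map. -/
def fredholmIndex {K V W : Type} [Field K] [AddCommGroup V] [Module K V] [AddCommGroup W]
    [Module K W] (φ : V →ₗ[K] W) : ℤ :=
  (Module.finrank K (LinearMap.ker φ) : ℤ) - Module.finrank K (W ⧸ LinearMap.range φ)

/-- The MQCA index of `α` is (well defined and) equal to `x`: for all sites `a ≤ b`, all subgroups
`F₀` between `F_{<a}` and `F_{<b}`, and all projections `ν` of `F` onto `F₀`, the compression of
`bar α` to `F₀` is Fredholm and half its index is `x`. -/
def MQCA.HasIndex {L S : Submodule (ZMod 2) (Pauli q)} (α : MQCA L S) (x : ℚ) : Prop :=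
  ∀ (a b : ℤ) (F₀ : Submodule (ZMod 2) (FSpace L S)) (ν : FSpace L S →ₗ[ZMod 2] F₀),
    a ≤ b → FLeft L S a ≤ F₀ → F₀ ≤ FLeft L S b → (∀ v : F₀, ν v = v) →
      IsFredholm (α.compression F₀ ν) ∧ (fredholmIndex (α.compression F₀ ν) : ℚ) / 2 = x

/-- There are admissible choices in the definition of the index, so its value is unique. -/
theorem MQCA.HasIndex.unique {L S : Submodule (ZMod 2) (Pauli q)} {α : MQCA L S} {x y : ℚ}
    (hx : α.HasIndex x) (hy : α.HasIndex y) : x = y := by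
  obtain ⟨ν, hν⟩ := (FLeft L S 0).subtype.exists_leftInverse_of_injective
    (Submodule.ker_subtype _)
  have h : ∀ v : FLeft L S 0, ν v = v := fun v => LinearMap.congr_fun hν v
  exact (hx 0 0 _ ν le_rfl le_rfl le_rfl h).2.symm.trans (hy 0 0 _ ν le_rfl le_rfl le_rfl h).2

/-! ## The action of a locally reversible transition on logical operators -/

theorem commForm_comm (P Q : Pauli q) : commForm q P Q = commForm q Q P := by
  classical
  change commFun q P Q = commFun q Q P
  rw [commFun_eq (Finset.subset_union_left (s₂ := Q.support)),
    commFun_eq (P := Q) (Finset.subset_union_right (s₁ := P.support))]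
  exact Finset.sum_congr rfl fun i _ => by ring

theorem commForm_eq_zero_of_disjoint {P Q : Pauli q}
    (h : ∀ k ∈ siteSupport P, k ∉ siteSupport Q) : commForm q P Q = 0 := by
  refine Finset.sum_eq_zero fun i hi => ?_
  have h1 : Q i = 0 := by
    by_contra hQ
    exact h i.1 ⟨i.2, Pauli.mem_support.1 hi⟩ ⟨i.2, hQ⟩
  simp [h1]

theorem finite_pauliOn {R : Set ℤ} (hR : R.Finite) : (pauliOn q R : Set (Pauli q)).Finite := by
  classical
  have hI : (Sigma.fst ⁻¹' R : Set (Σ k : ℤ, Fin (q k))).Finite := by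
    have : (Sigma.fst ⁻¹' R : Set (Σ k : ℤ, Fin (q k))) = R.sigma fun _ => Set.univ := by
      ext i; simp
    rw [this]
    have := hR.to_subtype
    rw [Set.sigma_eq_biUnion]
    exact hR.biUnion fun k _ => (Set.finite_univ).image _
  have : Finite (Sigma.fst ⁻¹' R : Set (Σ k : ℤ, Fin (q k))) := hI
  refine Set.Finite.of_injOn (f := fun (P : Pauli q) (i : Sigma.fst ⁻¹' R) => P i.1)
    (t := Set.univ) (fun _ _ => Set.mem_univ _) ?_ Set.finite_univ
  intro P hP Q hQ h
  ext1 i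
  by_cases hi : i.1 ∈ R
  · exact congrFun h ⟨i, hi⟩
  · have hP0 : P i = 0 := by
      by_contra h0
      exact hi (hP ⟨i.2, h0⟩)
    have hQ0 : Q i = 0 := by
      by_contra h0
      exact hi (hQ ⟨i.2, h0⟩)
    rw [hP0, hQ0]

theorem LocallyReversible.symm {A B : StabilizerGroup q} (h : LocallyReversible A B) :
    LocallyReversible B A := by
  obtain ⟨ℓ, GA, GB, h1, h2, h3, h4, h5, h6⟩ := h
  refine ⟨ℓ, GB, GA, h2, h1, by rwa [inf_comm], by rwa [inf_comm], ?_, ?_⟩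
  · intro b hb
    obtain ⟨a, ha, hab⟩ := h6 b hb
    exact ⟨a, ha, fun b' hb' => by rw [commForm_comm]; exact hab b' hb'⟩
  · intro a ha
    obtain ⟨b, hb, hab⟩ := h5 a ha
    exact ⟨b, hb, fun a' ha' => by rw [commForm_comm]; exact hab a' ha'⟩

theorem LocallyReversible.mem_right {A B : StabilizerGroup q} (h : LocallyReversible A B)
    {P : Pauli q} (hA : P ∈ A.group) (hB : P ∈ B.logicals) : P ∈ B.group := by
  obtain ⟨ℓ, GA, GB, h1, h2, h3, h4, h5, h6⟩ := h
  have hGB : ∀ b ∈ GB, b ∈ B.group := fun b hb => by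
    rw [← h4]; exact Submodule.mem_sup_left (Submodule.subset_span hb)
  rw [← h3] at hA
  obtain ⟨u, hu, s, hs, rfl⟩ := Submodule.mem_sup.1 hA
  suffices hu0 : u = 0 by
    rw [hu0, zero_add]; exact hs.2
  have hu' : ∀ b ∈ GB, commForm q u b = 0 := fun b hb => by
    have := hB b (hGB b hb)
    rwa [map_add, LinearMap.add_apply, B.abelian s hs.2 b (hGB b hb), add_zero] at this
  obtain ⟨c, hc, rfl⟩ := Submodule.mem_span_set.1 hu
  suffices hc0 : c = 0 by rw [hc0]; simp
  ext1 a
  by_contra hca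
  have haG : a ∈ GA := hc (Finsupp.mem_support_iff.2 hca)
  obtain ⟨b, hb, hab⟩ := h5 a haG
  have := hu' b hb
  rw [Finsupp.sum, map_sum, LinearMap.sum_apply, Finset.sum_eq_single a] at this
  · rw [map_smul, LinearMap.smul_apply, smul_eq_mul, mul_eq_zero] at this
    rcases this with h0 | h0
    · exact hca h0
    · exact (hab a haG).1 h0 rfl
  · intro a' ha' hne
    rw [map_smul, LinearMap.smul_apply, (hab a' (hc ha')).2 hne, smul_zero]
  · intro hna
    exact absurd (Finsupp.mem_support_iff.2 hca) hna

/-- Every logical operator of `A` can be multiplied by a stabilizer near its support so that it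
becomes a common logical operator of `A` and `B`. -/
theorem LocallyReversible.exists_common {A B : StabilizerGroup q} (h : LocallyReversible A B) :
    ∃ r : ℕ, ∀ P ∈ A.logicals, ∃ a ∈ A.group, P + a ∈ B.logicals ∧
      siteSupport (P + a) ⊆ nbhd r (siteSupport P) := by
  classical
  obtain ⟨ℓ, GA, GB, h1, h2, h3, h4, h5, h6⟩ := h
  have hGA : ∀ a ∈ GA, a ∈ A.group := fun b hb => by
    rw [← h3]; exact Submodule.mem_sup_left (Submodule.subset_span hb)
  refine ⟨2 * ℓ, fun P hP => ?_⟩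
  choose! σ hσ hσb using h6
  have hPs : (siteSupport P).Finite := by
    refine (P.support.image Sigma.fst).finite_toSet.subset ?_
    rintro k ⟨i, hi⟩
    simp only [Finset.coe_image, Set.mem_image]
    exact ⟨⟨k, i⟩, Pauli.mem_support.2 hi, rfl⟩
  have hnear : ∀ (R : Pauli q) (S : Pauli q), IsLocal ℓ S → commForm q R S ≠ 0 →
      siteSupport S ⊆ nbhd ℓ (siteSupport R) := by
    rintro R S ⟨k, hk⟩ hne m hm
    have : ∃ j ∈ siteSupport R, j ∈ siteSupport S := by
      by_contra hno
      push Not at hno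
      exact hne (commForm_eq_zero_of_disjoint hno)
    obtain ⟨j, hjR, hjS⟩ := this
    have e1 := hk hm
    have e2 := hk hjS
    simp only [Set.mem_Icc] at e1 e2
    exact ⟨j, hjR, abs_le.2 ⟨by omega, by omega⟩⟩
  have hnb : (nbhd ℓ (siteSupport P)).Finite := by
    have : nbhd ℓ (siteSupport P) = ⋃ j ∈ siteSupport P, Set.Icc (j - ℓ) (j + ℓ) := by
      ext k
      simp only [nbhd, Set.mem_ofPred_eq, Set.mem_iUnion, Set.mem_Icc, abs_le, exists_prop]
      constructor
      · rintro ⟨j, hj, e⟩; exact ⟨j, hj, by omega, by omega⟩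
      · rintro ⟨j, hj, e⟩; exact ⟨j, hj, by omega, by omega⟩
    rw [this]
    exact hPs.biUnion fun j _ => Set.finite_Icc _ _
  have hJ : {b ∈ GB | commForm q P b ≠ 0}.Finite :=
    (finite_pauliOn hnb).subset fun b hb => hnear P b (h2 b hb.1) hb.2
  set J : Finset (Pauli q) := hJ.toFinset with hJdef
  have hJm : ∀ b, b ∈ J ↔ b ∈ GB ∧ commForm q P b ≠ 0 := fun b => by simp [hJdef]
  have hsum : ∑ b ∈ J, σ b ∈ A.group :=
    Submodule.sum_mem _ fun b hb => hGA _ (hσ b ((hJm b).1 hb).1)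
  have hone : ∀ x : ZMod 2, x ≠ 0 → x = 1 := by decide
  refine ⟨∑ b ∈ J, σ b, hsum, ?_, ?_⟩
  · have hgen : ∀ b ∈ GB, commForm q (P + ∑ b ∈ J, σ b) b = 0 := by
      intro b hb
      rw [map_add, LinearMap.add_apply, map_sum, LinearMap.sum_apply]
      by_cases hbJ : b ∈ J
      · rw [Finset.sum_eq_single b]
        · rw [hone _ ((hJm b).1 hbJ).2,
            hone (commForm q (σ b) b) (fun h0 => (hσb b hb b hb).1 h0 rfl)]
          decide
        · intro b' hb' hne
          exact (hσb b' ((hJm b').1 hb').1 b hb).2 hne.symm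
        · exact fun hn => absurd hbJ hn
      · rw [Finset.sum_eq_zero, add_zero]
        · by_contra hne
          exact hbJ ((hJm b).2 ⟨hb, hne⟩)
        · intro b' hb'
          refine (hσb b' ((hJm b').1 hb').1 b hb).2 ?_
          rintro rfl
          exact hbJ hb'
    intro b hb
    rw [← h4] at hb
    obtain ⟨u, hu, s, hs, rfl⟩ := Submodule.mem_sup.1 hb
    have hle : Submodule.span (ZMod 2) GB ≤
        LinearMap.ker (commForm q (P + ∑ b ∈ J, σ b)) :=
      Submodule.span_le.2 fun b hb => hgen b hb
    rw [map_add, LinearMap.mem_ker.1 (hle hu), zero_add, map_add, LinearMap.add_apply,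
      hP s hs.1, A.abelian _ hsum s hs.1, add_zero]
  · have hmem : P + ∑ b ∈ J, σ b ∈ pauliOn q (nbhd (2 * ℓ) (siteSupport P)) := by
      refine Submodule.add_mem _ ?_ (Submodule.sum_mem _ fun b hb => ?_)
      · intro k hk
        exact ⟨k, hk, by simp⟩
      · intro k hk
        have hbG := ((hJm b).1 hb).1
        have hne : commForm q b (σ b) ≠ 0 := by
          rw [commForm_comm]
          exact fun h0 => (hσb b hbG b hbG).1 h0 rfl
        obtain ⟨m, hm, hkm⟩ := hnear b (σ b) (h1 _ (hσ b hbG)) hne hk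
        obtain ⟨j, hj, hmj⟩ := hnear P b (h2 b hbG) ((hJm b).1 hb).2 hm
        refine ⟨j, hj, ?_⟩
        have e1 := abs_le.1 hkm
        have e2 := abs_le.1 hmj
        exact abs_le.2 ⟨by push_cast; omega, by push_cast; omega⟩
    exact hmem

/-- The group of logical operators modulo stabilizers. -/
abbrev StabilizerGroup.Logical (A : StabilizerGroup q) : Type := LogicalQuot A.logicals A.group

/-- The classes, as logical operators of `A`, of the common logical operators of `A` and `B`. -/
def commonToLeft (A B : StabilizerGroup q) :
    (A.logicals ⊓ B.logicals : Submodule (ZMod 2) (Pauli q)) →ₗ[ZMod 2] A.Logical :=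
  (A.group.submoduleOf A.logicals).mkQ ∘ₗ Submodule.inclusion inf_le_left

/-- The classes, as logical operators of `B`, of the common logical operators of `A` and `B`. -/
def commonToRight (A B : StabilizerGroup q) :
    (A.logicals ⊓ B.logicals : Submodule (ZMod 2) (Pauli q)) →ₗ[ZMod 2] B.Logical :=
  (B.group.submoduleOf B.logicals).mkQ ∘ₗ Submodule.inclusion inf_le_right

theorem cls_eq_cls {L S : Submodule (ZMod 2) (Pauli q)} {P Q : L} :
    cls S P = cls S Q ↔ P.1 - Q.1 ∈ S := by
  simp only [cls, Submodule.mkQ_apply, Submodule.Quotient.eq]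
  rfl

theorem StabilizerGroup.group_le_logicals (A : StabilizerGroup q) : A.group ≤ A.logicals :=
  fun P hP a ha => A.abelian P hP a ha

theorem LocallyReversible.surjective_left {A B : StabilizerGroup q}
    (h : LocallyReversible A B) : Function.Surjective (commonToLeft A B) := by
  intro x
  obtain ⟨P, rfl⟩ := Submodule.mkQ_surjective _ x
  obtain ⟨r, hr⟩ := h.exists_common
  obtain ⟨a, ha, hB, -⟩ := hr P.1 P.2
  refine ⟨⟨P.1 + a, A.logicals.add_mem P.2 (A.group_le_logicals ha), hB⟩, ?_⟩
  refine (cls_eq_cls (S := A.group) (P := ⟨P.1 + a, _⟩) (Q := P)).2 ?_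
  simpa using ha

theorem LocallyReversible.surjective_right {A B : StabilizerGroup q}
    (h : LocallyReversible A B) : Function.Surjective (commonToRight A B) := by
  intro x
  obtain ⟨⟨P, hP⟩, hx⟩ := h.symm.surjective_left x
  exact ⟨⟨P, hP.2, hP.1⟩, hx⟩

theorem LocallyReversible.ker_eq {A B : StabilizerGroup q} (h : LocallyReversible A B) :
    LinearMap.ker (commonToLeft A B) = LinearMap.ker (commonToRight A B) := by
  ext P
  have hl : P ∈ LinearMap.ker (commonToLeft A B) ↔ P.1 ∈ A.group := by
    rw [LinearMap.mem_ker, commonToLeft, LinearMap.comp_apply, Submodule.mkQ_apply,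
      Submodule.Quotient.mk_eq_zero]
    rfl
  have hr : P ∈ LinearMap.ker (commonToRight A B) ↔ P.1 ∈ B.group := by
    rw [LinearMap.mem_ker, commonToRight, LinearMap.comp_apply, Submodule.mkQ_apply,
      Submodule.Quotient.mk_eq_zero]
    rfl
  rw [hl, hr]
  exact ⟨fun hP => h.mem_right hP P.2.2, fun hP => h.symm.mem_right hP P.2.1⟩

/-- The action of a locally reversible transition `A → B` on logical operators: the class of a
common logical operator of `A` and `B` is sent to the class of the same operator. -/
def LocallyReversible.transition {A B : StabilizerGroup q} (h : LocallyReversible A B) :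
    A.Logical ≃ₗ[ZMod 2] B.Logical :=
  ((commonToLeft A B).quotKerEquivOfSurjective h.surjective_left).symm ≪≫ₗ
    Submodule.quotEquivOfEq _ _ h.ker_eq ≪≫ₗ
      (commonToRight A B).quotKerEquivOfSurjective h.surjective_right

theorem LocallyReversible.transition_cls {A B : StabilizerGroup q} (h : LocallyReversible A B)
    (P : Pauli q) (hA : P ∈ A.logicals) (hB : P ∈ B.logicals) :
    h.transition (cls A.group ⟨P, hA⟩) = cls B.group ⟨P, hB⟩ := by
  have h1 : cls A.group ⟨P, hA⟩ =
      (commonToLeft A B).quotKerEquivOfSurjective h.surjective_left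
        (Submodule.Quotient.mk ⟨P, hA, hB⟩) := rfl
  rw [LocallyReversible.transition, LinearEquiv.trans_apply, LinearEquiv.trans_apply, h1,
    LinearEquiv.symm_apply_apply]
  rfl

/-! ## Periodic locally reversible measurement circuits -/

/-- A one-dimensional periodic locally reversible measurement circuit, given by its sequence
`A 0 → A 1 → ⋯ → A T = A 0` of instantaneous stabilizer groups.  Only the values `A t` with
`t ≤ T` matter.  Local generation is inherited by every `A t` from the base group `A 0`. -/
structure PLRMC (q : ℤ → ℕ) where
  T : ℕ
  A : ℕ → StabilizerGroup q
  base_locallyGenerated : (A 0).LocallyGenerated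
  reversible : ∀ t < T, LocallyReversible (A t) (A (t + 1))
  periodic : A T = A 0

namespace PLRMC

/-- The evolution of the logical operators of the base group during the first `t` steps. -/
def evolution (C : PLRMC q) : (t : ℕ) → t ≤ C.T → ((C.A 0).Logical ≃ₗ[ZMod 2] (C.A t).Logical)
  | 0, _ => LinearEquiv.refl _ _
  | t + 1, h => C.evolution t (Nat.le_of_succ_le h) ≪≫ₗ (C.reversible t h).transition

/-- The identification of the logical operators of equal stabilizer groups. -/
def logicalOfEq {A B : StabilizerGroup q} (h : A = B) : A.Logical ≃ₗ[ZMod 2] B.Logical :=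
  h ▸ LinearEquiv.refl _ _

theorem logicalOfEq_cls {A B : StabilizerGroup q} (h : A = B) (P : A.logicals) :
    logicalOfEq h (cls A.group P) = cls B.group ⟨P.1, h ▸ P.2⟩ := by
  subst h
  rfl

theorem evolution_range (C : PLRMC q) (t : ℕ) (h : t ≤ C.T) :
    ∃ r : ℕ, ∀ P : (C.A 0).logicals, ∃ Q : (C.A t).logicals,
      C.evolution t h (cls _ P) = cls _ Q ∧ siteSupport Q.1 ⊆ nbhd r (siteSupport P.1) := by
  induction t with
  | zero => exact ⟨0, fun P => ⟨P, rfl, fun k hk => ⟨k, hk, by simp⟩⟩⟩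
  | succ t ih =>
    obtain ⟨r, hr⟩ := ih (Nat.le_of_succ_le h)
    obtain ⟨s, hs⟩ := (C.reversible t h).exists_common
    refine ⟨r + s, fun P => ?_⟩
    obtain ⟨Q, hQ, hQr⟩ := hr P
    obtain ⟨a, ha, hB, has⟩ := hs Q.1 Q.2
    have hA : Q.1 + a ∈ (C.A t).logicals :=
      Submodule.add_mem _ Q.2 ((C.A t).group_le_logicals ha)
    refine ⟨⟨Q.1 + a, hB⟩, ?_, fun k hk => ?_⟩
    · have e : cls (C.A t).group Q = cls (C.A t).group ⟨Q.1 + a, hA⟩ := by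
        rw [cls_eq_cls]
        simpa using ha
      rw [← (C.reversible t h).transition_cls _ hA hB, ← e, ← hQ]
      rfl
    · obtain ⟨m, hm, hkm⟩ := has hk
      obtain ⟨j, hj, hmj⟩ := hQr hm
      have e1 := abs_le.1 hkm
      have e2 := abs_le.1 hmj
      exact ⟨j, hj, abs_le.2 ⟨by push_cast; omega, by push_cast; omega⟩⟩

/-- The canonical MQCA of a one-dimensional circuit: the evolution during one period of the
finitely supported logical operators of the base group, modulo its stabilizers. -/
def canonicalMQCA (C : PLRMC q) : MQCA (C.A 0).logicals (C.A 0).group where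
  toEquiv := C.evolution C.T le_rfl ≪≫ₗ logicalOfEq C.periodic
  finite_range := by
    obtain ⟨r, hr⟩ := C.evolution_range C.T le_rfl
    refine ⟨r, fun P => ?_⟩
    obtain ⟨Q, hQ, hs⟩ := hr P
    refine ⟨⟨Q.1, C.periodic ▸ Q.2⟩, ?_, hs⟩
    rw [LinearEquiv.trans_apply, hQ, logicalOfEq_cls]

end PLRMC

/-! ## The Majorana chain algebra -/

/-- The operator `X_j Z_{j+1}` on the chain with one qubit per site. -/
def majoranaGen (j : ℤ) : Pauli fun _ => 1 :=
  Pauli.single ⟨j, 0⟩ (1, 0) + Pauli.single ⟨j + 1, 0⟩ (0, 1)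

/-- The group generated by all operators `X_j Z_{j+1}`. -/
def majoranaChain : Submodule (ZMod 2) (Pauli fun _ => 1) :=
  Submodule.span (ZMod 2) (Set.range majoranaGen)

theorem majoranaGen_mem (j : ℤ) : majoranaGen j ∈ majoranaChain :=
  Submodule.subset_span ⟨j, rfl⟩

end

/-! The index measures how far an automaton `e` moves a half-line of `F`. If `V` is commensurable
with `e V`, the compression of `e` to `V` is Fredholm, and its index is `dim W/V - dim W/eV` for
every `W` that contains both with finite relative dimensions (`fredholm_compression`). Relative
dimensions add up and are preserved by `e`, so the number depends neither on `V` nor on `W` nor on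
the projection. Each site carries finitely many qubits, so the steps of the filtration `F_{<a}` are
finite-dimensional. Hence every automaton whose inverse has finite range has an index, computable
from any convenient `V` and `W` (`MQCA.hasIndex_of_inverse`).

Integrality is a parity statement. For a locally generated stabilizer group, the logical operators
that commute with all logical operators are exactly those whose classes are products of classes at
infinity, so commutation descends to a nondegenerate alternating form on `F` (`exists_form`). The
obstruction to splitting `F` as `F_{<a}` plus its orthogonal complement comes from stabilizers
truncated at the cut. Local generation makes it finite-dimensional, and finitely many extra vectors
turn `F_{<a}` into a subspace `V` with `V + V^⊥ = F` (`exists_orthogonal_summand`). Such splittings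
are preserved by the automaton of a circuit, which is an isometry because each transition keeps
common representatives. If `V ≤ W` both split, `W/V` is isomorphic to `W ∩ V^⊥`, which is
nondegenerate and hence even-dimensional (`even_relDim`). Both terms of the index are then even, and
half of it is an integer.

In the Majorana chain each site adds only one dimension to the filtration, so translation by one
site has Fredholm index one. -/

noncomputable section

variable {q : ℤ → ℕ}

/-! ## Relative dimensions of subspaces -/

section RelativeDimension

variable {K F : Type} [Field K] [AddCommGroup F] [Module K F]

/-- The dimension of `W / U`, for subspaces `U ≤ W`. -/
def relDim (U W : Submodule K F) : ℕ := Module.finrank K (W.map U.mkQ)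

theorem map_mkQ_eq_map_factor {U V : Submodule K F} (h : U ≤ V) (W : Submodule K F) :
    W.map V.mkQ = (W.map U.mkQ).map (Submodule.factor h) := by
  rw [← Submodule.map_comp, Submodule.factor_comp_mk]

theorem finite_map_mkQ_mono {U V W X : Submodule K F} (h : U ≤ V) (hW : W ≤ X)
    [Module.Finite K (X.map U.mkQ)] : Module.Finite K (W.map V.mkQ) := by
  have : Module.Finite K (X.map V.mkQ) := by
    rw [map_mkQ_eq_map_factor h]
    infer_instance
  exact Submodule.finiteDimensional_of_le (Submodule.map_mono hW)

/-- Rank-nullity for the projection from `W / U` onto `W / V`, whose kernel is `V / U`. -/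
theorem relDim_add {U V W : Submodule K F} (hUV : U ≤ V) (hVW : V ≤ W)
    [Module.Finite K (W.map U.mkQ)] : relDim U V + relDim V W = relDim U W := by
  have h := LinearMap.finrank_range_add_finrank_ker
    ((Submodule.factor hUV).domRestrict (W.map U.mkQ))
  rw [LinearMap.range_domRestrict, ← map_mkQ_eq_map_factor, LinearMap.ker_domRestrict] at h
  have hk : LinearMap.ker (Submodule.factor hUV) = V.map U.mkQ := by
    rw [Submodule.factor, Submodule.mapQ, Submodule.ker_liftQ]
    simp
  rw [hk, ((Submodule.comapSubtypeEquivOfLe (Submodule.map_mono hVW))).finrank_eq] at h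
  rw [relDim, relDim, relDim, ← h, add_comm]

theorem relDim_map (e : F ≃ₗ[K] F) (U W : Submodule K F) :
    relDim (U.map (e : F →ₗ[K] F)) (W.map (e : F →ₗ[K] F)) = relDim U W := by
  have h : (W.map (e : F →ₗ[K] F)).map (U.map (e : F →ₗ[K] F)).mkQ =
      (W.map U.mkQ).map (Submodule.Quotient.equiv U (U.map (e : F →ₗ[K] F)) e rfl : _ →ₗ[K] _) := by
    rw [← Submodule.map_comp, ← Submodule.map_comp]
    rfl
  rw [relDim, h, relDim, LinearEquiv.finrank_map_eq]

/-- If `g` has finite-dimensional range and its kernel is contained in that of `f`, then `f` has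
finite-dimensional range. -/
theorem finite_range_of_ker_le {V X Y : Type} [AddCommGroup V] [Module K V] [AddCommGroup X]
    [Module K X] [AddCommGroup Y] [Module K Y] {f : V →ₗ[K] X} {g : V →ₗ[K] Y}
    (h : LinearMap.ker g ≤ LinearMap.ker f) [Module.Finite K (LinearMap.range g)] :
    Module.Finite K (LinearMap.range f) := by
  have : Module.Finite K (V ⧸ LinearMap.ker g) := Module.Finite.equiv g.quotKerEquivRange.symm
  rw [← Submodule.range_liftQ (LinearMap.ker g) f h]
  infer_instance

/-- The compression of an automorphism `e` to a subspace `V` is Fredholm if `e V` is commensurable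
with `V`, and its index compares `V` with `e V` inside any large enough subspace `W`. -/
theorem fredholm_compression (e : F ≃ₗ[K] F) {V W : Submodule K F} (ν : F →ₗ[K] V)
    (hν : ∀ v : V, ν v = v) (hVW : V ≤ W) (heW : V.map (e : F →ₗ[K] F) ≤ W)
    [Module.Finite K (W.map V.mkQ)] [Module.Finite K (W.map (V.map (e : F →ₗ[K] F)).mkQ)] :
    IsFredholm (ν ∘ₗ (e : F →ₗ[K] F) ∘ₗ V.subtype) ∧
      fredholmIndex (ν ∘ₗ (e : F →ₗ[K] F) ∘ₗ V.subtype) =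
        relDim V W - relDim (V.map (e : F →ₗ[K] F)) W := by
  set φ := ν ∘ₗ (e : F →ₗ[K] F) ∘ₗ V.subtype with hφ
  set U := V.map (e : F →ₗ[K] F) with hU
  -- The projection `ν` splits `W` as `V ⊕ N`. The compression will be traded for the map `g : N → W
  -- / U` between finite-dimensional spaces.
  set N : Submodule K F := W ⊓ LinearMap.ker ν with hN
  have hsub : ∀ w ∈ W, w - ν w ∈ N := fun w hw =>
    ⟨W.sub_mem hw (hVW (ν w).2), by simp [hν]⟩
  have hνN : ∀ x ∈ N, ν x = 0 := fun x hx => hx.2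
  -- `N` is isomorphic to `W / V`
  have eN : N ≃ₗ[K] W.map V.mkQ := by
    refine LinearEquiv.ofBijective ((V.mkQ.restrict (p := N) (q := W.map V.mkQ)
      fun x hx => ⟨x, hx.1, rfl⟩)) ⟨?_, ?_⟩
    · rw [injective_iff_map_eq_zero]
      rintro ⟨x, hx⟩ h
      have hxV : x ∈ V := (Submodule.Quotient.mk_eq_zero V).1 (congrArg Subtype.val h)
      have := hν ⟨x, hxV⟩
      rw [hνN x hx] at this
      exact Subtype.ext (congrArg Subtype.val this).symm
    · rintro ⟨_, w, hw, rfl⟩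
      refine ⟨⟨w - ν w, hsub w hw⟩, Subtype.ext ((Submodule.Quotient.eq V).2 ?_)⟩
      simp
  have : Module.Finite K N := Module.Finite.equiv eN.symm
  -- the map from `N` to `W / U`
  let g : N →ₗ[K] W.map U.mkQ := U.mkQ.restrict fun x hx => ⟨x, hx.1, rfl⟩
  have hker : ∀ x : N, x ∈ LinearMap.ker g ↔ x.1 ∈ U := fun x => by
    rw [LinearMap.mem_ker, Subtype.ext_iff]
    exact Submodule.Quotient.mk_eq_zero U
  -- Both kernels are `U ∩ ker ν`: `e` carries the vectors of `V` killed by `φ` onto it, and it is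
  -- the part of `N` inside `U`.
  have eker : LinearMap.ker φ ≃ₗ[K] LinearMap.ker g := by
    refine LinearEquiv.ofBijective
      { toFun := fun x => ⟨⟨e x.1, heW ⟨x.1, x.1.2, rfl⟩, x.2⟩, (hker _).2 ⟨x.1, x.1.2, rfl⟩⟩
        map_add' := fun x y => by ext; simp
        map_smul' := fun c x => by ext; simp } ⟨?_, ?_⟩
    · intro x y h
      have h1 : e x.1 = e y.1 := congrArg (fun z => (z.1.1 : F)) h
      exact Subtype.ext (Subtype.ext (e.injective h1))
    · rintro ⟨x, hx⟩
      obtain ⟨v, hv, hvx⟩ := (hker x).1 hx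
      refine ⟨⟨⟨v, hv⟩, ?_⟩, Subtype.ext (Subtype.ext hvx)⟩
      change ν (e v) = 0
      exact (congrArg ν hvx).trans (hνN _ x.2)
  -- Both cokernels are the quotient of `W` by `U + N`: modulo `N`, a vector `w` of `W` is the same
  -- as `ν w`.
  have ecoker : (W.map U.mkQ ⧸ LinearMap.range g) ≃ₗ[K] (V ⧸ LinearMap.range φ) := by
    let f : W →ₗ[K] (V ⧸ LinearMap.range φ) := (LinearMap.range φ).mkQ ∘ₗ ν ∘ₗ W.subtype
    let p : W →ₗ[K] (W.map U.mkQ ⧸ LinearMap.range g) :=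
      (LinearMap.range g).mkQ ∘ₗ U.mkQ.restrict fun x hx => ⟨x, hx, rfl⟩
    have hf : Function.Surjective f := by
      intro y
      obtain ⟨v, rfl⟩ := Submodule.mkQ_surjective _ y
      exact ⟨⟨v, hVW v.2⟩, by simp [f, hν]⟩
    have hp : Function.Surjective p := by
      intro y
      obtain ⟨⟨_, w, hw, rfl⟩, rfl⟩ := Submodule.mkQ_surjective _ y
      exact ⟨⟨w, hw⟩, rfl⟩
    have hfp : LinearMap.ker p = LinearMap.ker f := by
      ext w
      have h1 : w ∈ LinearMap.ker p ↔ ∃ x : N, x.1 - w.1 ∈ U := by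
        simp only [p, LinearMap.mem_ker, LinearMap.comp_apply, Submodule.mkQ_apply,
          Submodule.Quotient.mk_eq_zero, LinearMap.mem_range]
        refine exists_congr fun x => ?_
        rw [Subtype.ext_iff]
        exact Submodule.Quotient.eq U
      have h2 : w ∈ LinearMap.ker f ↔ ∃ v : V, ν (e v) = ν w := by
        simp only [f, LinearMap.mem_ker, LinearMap.comp_apply, Submodule.mkQ_apply,
          Submodule.Quotient.mk_eq_zero, LinearMap.mem_range]
        rfl
      rw [h1, h2]
      constructor
      · rintro ⟨x, v, hv, hvx⟩
        refine ⟨-⟨v, hv⟩, ?_⟩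
        have : e v = x.1 - w.1 := hvx
        rw [Submodule.coe_neg, map_neg, map_neg, this, map_sub, hνN _ x.2]
        simp
      · rintro ⟨v, hv⟩
        refine ⟨⟨w - e v, W.sub_mem w.2 (heW ⟨v, v.2, rfl⟩), ?_⟩, ?_⟩
        · rw [SetLike.mem_coe, LinearMap.mem_ker, map_sub, hv, sub_self]
        · exact ⟨-v, V.neg_mem v.2, by simp⟩
    exact (p.quotKerEquivOfSurjective hp).symm ≪≫ₗ Submodule.quotEquivOfEq _ _ hfp ≪≫ₗ
      f.quotKerEquivOfSurjective hf
  refine ⟨⟨Module.Finite.equiv eker.symm, Module.Finite.equiv ecoker⟩, ?_⟩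
  -- The index of `g` is the difference of the dimensions of its source `N ≅ W / V` and its target
  -- `W / U`.
  have h1 := LinearMap.finrank_range_add_finrank_ker g
  have h2 := Submodule.finrank_quotient_add_finrank (LinearMap.range g)
  rw [fredholmIndex, relDim, relDim, eker.finrank_eq, ← ecoker.finrank_eq, ← eN.finrank_eq]
  omega

/-- A subspace is bounded by a filtration if it lies between two of its members. -/
def IsBetween (Φ : ℤ → Submodule K F) (V : Submodule K F) : Prop := ∃ a b, Φ a ≤ V ∧ V ≤ Φ b

variable {Φ : ℤ → Submodule K F}

theorem IsBetween.finite (hfin : ∀ a b, Module.Finite K ((Φ b).map (Φ a).mkQ))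
    {U W : Submodule K F} (hU : IsBetween Φ U) (hW : IsBetween Φ W) :
    Module.Finite K (W.map U.mkQ) := by
  obtain ⟨a, -, ha, -⟩ := hU
  obtain ⟨-, b, -, hb⟩ := hW
  have := hfin a b
  exact finite_map_mkQ_mono ha hb

theorem IsBetween.map {e : F ≃ₗ[K] F} {r : ℤ}
    (he : ∀ a, (Φ a).map (e : F →ₗ[K] F) ≤ Φ (a + r))
    (he' : ∀ a, (Φ a).map (e.symm : F →ₗ[K] F) ≤ Φ (a + r)) {V : Submodule K F}
    (hV : IsBetween Φ V) : IsBetween Φ (V.map (e : F →ₗ[K] F)) := by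
  obtain ⟨a, b, ha, hb⟩ := hV
  -- The lower bound uses the inverse, which moves `Φ (a - r)` into `Φ a ≤ V`.
  refine ⟨a - r, b + r, fun x hx => ⟨e.symm x, ha ?_, by simp⟩, (Submodule.map_mono hb).trans (he b)⟩
  have := he' (a - r) ⟨x, hx, rfl⟩
  rwa [sub_add_cancel] at this

/-- All compressions of an automorphism to subspaces bounded by the filtration have the same index,
which can be computed from any one of these subspaces. -/
theorem fredholm_compression_of_isBetween (hmono : Monotone Φ)
    (hfin : ∀ a b, Module.Finite K ((Φ b).map (Φ a).mkQ)) {e : F ≃ₗ[K] F} {r : ℤ}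
    (he : ∀ a, (Φ a).map (e : F →ₗ[K] F) ≤ Φ (a + r))
    (he' : ∀ a, (Φ a).map (e.symm : F →ₗ[K] F) ≤ Φ (a + r))
    {V₀ W₀ : Submodule K F} (hV₀ : IsBetween Φ V₀) (hW₀ : IsBetween Φ W₀) (hVW : V₀ ≤ W₀)
    (heW : V₀.map (e : F →ₗ[K] F) ≤ W₀) {V : Submodule K F} (hV : IsBetween Φ V) (ν : F →ₗ[K] V)
    (hν : ∀ v : V, ν v = v) :
    IsFredholm (ν ∘ₗ (e : F →ₗ[K] F) ∘ₗ V.subtype) ∧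
      fredholmIndex (ν ∘ₗ (e : F →ₗ[K] F) ∘ₗ V.subtype) =
        relDim V₀ W₀ - relDim (V₀.map (e : F →ₗ[K] F)) W₀ := by
  have hmapB : ∀ {V : Submodule K F}, IsBetween Φ V → IsBetween Φ (V.map (e : F →ₗ[K] F)) :=
    fun h => h.map he he'
  have hb : ∀ a, IsBetween Φ (Φ a) := fun a => ⟨a, a, le_rfl, le_rfl⟩
  -- enlarging `V` does not change the difference
  have key : ∀ {U V W : Submodule K F}, IsBetween Φ U → IsBetween Φ V → IsBetween Φ W → U ≤ V →
      V ≤ W → V.map (e : F →ₗ[K] F) ≤ W →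
      (relDim U W - relDim (U.map (e : F →ₗ[K] F)) W : ℤ) =
        relDim V W - relDim (V.map (e : F →ₗ[K] F)) W := by
    intro U V W hU hV hW hUV hVW heVW
    have := hU.finite hfin hW
    have := (hmapB hU).finite hfin hW
    have h1 := relDim_add hUV hVW
    have h2 := relDim_add (Submodule.map_mono hUV : U.map (e : F →ₗ[K] F) ≤ _) heVW
    -- The dimension of `V / U` equals that of `eV / eU`, so it cancels from the difference.
    rw [relDim_map] at h2
    omega
  -- enlarging `W` does not change the difference
  have key' : ∀ {V W X : Submodule K F}, IsBetween Φ V → IsBetween Φ W → IsBetween Φ X → V ≤ W →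
      V.map (e : F →ₗ[K] F) ≤ W → W ≤ X →
      (relDim V W - relDim (V.map (e : F →ₗ[K] F)) W : ℤ) =
        relDim V X - relDim (V.map (e : F →ₗ[K] F)) X := by
    intro V W X hV hW hX hVW heVW hWX
    have := hV.finite hfin hX
    have := (hmapB hV).finite hfin hX
    have h1 := relDim_add hVW hWX
    have h2 := relDim_add heVW hWX
    omega
  obtain ⟨a, b, ha, hbV⟩ := hV
  obtain ⟨a₀, -, ha₀, -⟩ := id hV₀
  obtain ⟨-, c₀, -, hc₀⟩ := id hW₀
  -- `V` and `V₀` need not be comparable. Both contain `Φ m`, and everything lies in `Φ M`, so each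
  -- is compared with `Φ m` inside `Φ M`.
  obtain ⟨m, hma, hma₀⟩ := exists_le_le a a₀
  obtain ⟨M, hbM, hM⟩ := exists_ge_ge b (max (b + r) c₀)
  obtain ⟨hrM, hcM⟩ := max_le_iff.1 hM
  have hVM : V ≤ Φ M := hbV.trans (hmono hbM)
  have heVM : V.map (e : F →ₗ[K] F) ≤ Φ M :=
    ((Submodule.map_mono hbV).trans (he b)).trans (hmono hrM)
  have hW₀M : W₀ ≤ Φ M := hc₀.trans (hmono hcM)
  have hV' : IsBetween Φ V := ⟨a, b, ha, hbV⟩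
  have hmV : Φ m ≤ V := (hmono hma).trans ha
  have hmV₀ : Φ m ≤ V₀ := (hmono hma₀).trans ha₀
  have := hV'.finite hfin (hb M)
  have := (hmapB hV').finite hfin (hb M)
  obtain ⟨h1, h2⟩ := fredholm_compression e ν hν hVM heVM
  refine ⟨h1, ?_⟩
  rw [h2, ← key (hb m) hV' (hb M) hmV hVM heVM, key' hV₀ hW₀ (hb M) hVW heW hW₀M,
    key (hb m) hV₀ (hb M) hmV₀ (hVW.trans hW₀M) (heW.trans hW₀M)]

end RelativeDimension

/-! ## Alternating forms -/

section Alternating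

variable {K F : Type} [Field K] [AddCommGroup F] [Module K F]

/-- If the range of `B` is finite-dimensional, then each functional that vanishes where all `B u`
vanish is represented by `B`. -/
theorem exists_eq_of_forall_eq_zero {U : Type} [AddCommGroup U] [Module K U]
    (B : U →ₗ[K] F →ₗ[K] K) [Module.Finite K (LinearMap.range B)] (f : F →ₗ[K] K)
    (hf : ∀ x, (∀ u, B u x = 0) → f x = 0) : ∃ u, B u = f := by
  let R : Submodule K (Module.Dual K F) := LinearMap.range B
  have : FiniteDimensional K R := ‹_›
  have h : f ∈ R.dualCoannihilator.dualAnnihilator := by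
    rw [Submodule.mem_dualAnnihilator]
    intro x hx
    refine hf x fun u => ?_
    exact (Submodule.mem_dualCoannihilator x).1 hx _ ⟨u, rfl⟩
  rwa [Subspace.dualCoannihilator_dualAnnihilator_eq] at h

/-- A maximal isotropic subspace is its own orthogonal complement, so its dimension is half that of
the space. Only `B x x = 0` is used, so characteristic two is allowed. -/
theorem even_finrank_of_nondegenerate [Module.Finite K F] (B : F →ₗ[K] F →ₗ[K] K) (hB : B.IsAlt)
    (hB' : ∀ x, (∀ y, B x y = 0) → x = 0) : Even (Module.finrank K F) := by
  obtain ⟨U, hU, hmax⟩ := set_has_maximal_iff_noetherian.2 (inferInstance : IsNoetherian K F)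
    {U : Submodule K F | ∀ x ∈ U, ∀ y ∈ U, B x y = 0} ⟨⊥, by simp +contextual⟩
  have hle : U ≤ U.orthogonalBilin B := fun x hx y hy => hU y hy x hx
  have heq : U = U.orthogonalBilin B := by
    refine le_antisymm hle fun x hx => ?_
    by_contra hxU
    -- A vector orthogonal to `U` but outside it could be added to `U`, against maximality.
    refine hmax (U ⊔ K ∙ x) ?_ ?_
    · rintro y hy z hz
      obtain ⟨u, hu, _, hc, rfl⟩ := Submodule.mem_sup.1 hy
      obtain ⟨c, rfl⟩ := Submodule.mem_span_singleton.1 hc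
      obtain ⟨v, hv, _, hd, rfl⟩ := Submodule.mem_sup.1 hz
      obtain ⟨d, rfl⟩ := Submodule.mem_span_singleton.1 hd
      simp [hU u hu v hv, hx u hu, hB.isRefl _ _ (hx v hv), hB x]
    · refine lt_of_le_of_ne le_sup_left fun h => hxU ?_
      rw [h]
      exact Submodule.mem_sup_right (Submodule.mem_span_singleton_self x)
  have hnd : LinearMap.BilinForm.Nondegenerate B := by
    exact hB.isRefl.nondegenerate_iff_separatingLeft.2 hB'
  have h := LinearMap.BilinForm.finrank_orthogonal hnd U
  have h' : Module.finrank K (LinearMap.BilinForm.orthogonal B U) = Module.finrank K U := by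
    conv_rhs => rw [heq]
    rfl
  have := Submodule.finrank_le U
  exact ⟨Module.finrank K U, by omega⟩

/-- A vector of `V ∩ V^⊥` is orthogonal to `V^⊥` and to `V`, hence to everything. -/
theorem disjoint_orthogonal_of_sup_eq_top {B : F →ₗ[K] F →ₗ[K] K} (hB : B.IsAlt)
    (hB' : ∀ x, (∀ y, B x y = 0) → x = 0) {V : Submodule K F}
    (hV : V ⊔ V.orthogonalBilin B = ⊤) {x : F} (hx : x ∈ V) (hx' : x ∈ V.orthogonalBilin B) :
    x = 0 := by
  refine hB' x fun y => ?_
  obtain ⟨v, hv, w, hw, rfl⟩ := Submodule.mem_sup.1 (hV ▸ Submodule.mem_top : y ∈ _)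
  rw [map_add, hw x hx, hB.isRefl _ _ (hx' v hv), add_zero]

/-- Two nested orthogonal summands have even relative dimension. -/
theorem even_relDim {B : F →ₗ[K] F →ₗ[K] K} (hB : B.IsAlt)
    (hB' : ∀ x, (∀ y, B x y = 0) → x = 0) {V W : Submodule K F} (hVW : V ≤ W)
    (hV : V ⊔ V.orthogonalBilin B = ⊤) (hW : W ⊔ W.orthogonalBilin B = ⊤)
    [Module.Finite K (W.map V.mkQ)] : Even (relDim V W) := by
  have hdec : ∀ w ∈ W, ∃ v ∈ V, w - v ∈ W ⊓ V.orthogonalBilin B := fun w hw => by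
    obtain ⟨v, hv, u, hu, rfl⟩ := Submodule.mem_sup.1 (hV ▸ Submodule.mem_top : w ∈ _)
    exact ⟨v, hv, W.sub_mem hw (hVW hv), by simpa using hu⟩
  -- Splitting along `V` gives `W = V ⊕ (W ∩ V^⊥)`, so `W ∩ V^⊥` is a model of `W / V`.
  have e : (W ⊓ V.orthogonalBilin B : Submodule K F) ≃ₗ[K] W.map V.mkQ := by
    refine LinearEquiv.ofBijective (V.mkQ.restrict (p := W ⊓ V.orthogonalBilin B)
      (q := W.map V.mkQ) fun x hx => ⟨x, hx.1, rfl⟩) ⟨?_, ?_⟩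
    · rw [injective_iff_map_eq_zero]
      rintro ⟨x, hx⟩ h
      have hxV : x ∈ V := (Submodule.Quotient.mk_eq_zero V).1 (congrArg Subtype.val h)
      exact Subtype.ext (disjoint_orthogonal_of_sup_eq_top hB hB' hV hxV hx.2)
    · rintro ⟨_, w, hw, rfl⟩
      obtain ⟨v, hv, h⟩ := hdec w hw
      refine ⟨⟨w - v, h⟩, Subtype.ext ((Submodule.Quotient.eq V).2 ?_)⟩
      simpa using hv
  have : Module.Finite K (W ⊓ V.orthogonalBilin B : Submodule K F) := Module.Finite.equiv e.symm
  rw [relDim, ← e.finrank_eq]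
  refine even_finrank_of_nondegenerate (B.domRestrict₁₂ _ _) (fun x => hB x.1) fun x hx => ?_
  -- Nondegeneracy on `W ∩ V^⊥`: a vector orthogonal to it is also orthogonal to `V` and to `W^⊥`,
  -- and these three subspaces span `F`.
  refine Subtype.ext (hB' _ fun y => ?_)
  obtain ⟨w, hw, u, hu, rfl⟩ := Submodule.mem_sup.1 (hW ▸ Submodule.mem_top : y ∈ _)
  obtain ⟨v, hv, h⟩ := hdec w hw
  have h1 : B x (w - v) = 0 := hx ⟨w - v, h⟩
  rw [map_add, hu x x.2.1, add_zero, ← sub_add_cancel w v, map_add, h1,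
    hB.isRefl _ _ (x.2.2 v hv), zero_add]

/-- A subspace with finite-dimensional radical `R`, such that all vectors orthogonal to `R` come
from the subspace and its orthogonal complement, is enlarged to an orthogonal summand by finitely
many vectors. -/
theorem exists_sup_orthogonal_eq_top {B : F →ₗ[K] F →ₗ[K] K} (hB : B.IsAlt)
    (hB' : ∀ x, (∀ y, B x y = 0) → x = 0) {V R : Submodule K F} [Module.Finite K R] (hRV : R ≤ V)
    (hRV' : R ≤ V.orthogonalBilin B)
    (hR : R.orthogonalBilin B ≤ V ⊔ V.orthogonalBilin B) :
    ∃ R' : Submodule K F, Module.Finite K R' ∧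
      (V ⊔ R') ⊔ (V ⊔ R').orthogonalBilin B = ⊤ := by
  let C : F →ₗ[K] (R →ₗ[K] K) := B.domRestrict₂ R
  -- By nondegeneracy and finiteness of `R`, every functional on `R` is a pairing with some vector.
  -- The range of a section `s` is the enlargement: a copy of the dual of `R`.
  have hC : Function.Surjective C := fun f =>
    exists_eq_of_forall_eq_zero C f fun r hr => by
      have : r = 0 := Subtype.ext (hB' _ fun y => hB.isRefl _ _ (hr y))
      rw [this, map_zero]
  obtain ⟨s, hs⟩ := C.exists_rightInverse_of_surjective (LinearMap.range_eq_top.2 hC)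
  have hs' : ∀ (f : R →ₗ[K] K) (r : R), B (s f) r = f r := fun f r =>
    LinearMap.congr_fun (LinearMap.congr_fun hs f) r
  refine ⟨LinearMap.range s, inferInstance, ?_⟩
  rw [eq_top_iff]
  intro x _
  have hx : x - s (C x) ∈ R.orthogonalBilin B := by
    intro r hr
    refine hB.isRefl _ _ ?_
    rw [map_sub, LinearMap.sub_apply]
    exact sub_eq_zero.2 (hs' (C x) ⟨r, hr⟩).symm
  obtain ⟨v, hv, w, hw, hvw⟩ := Submodule.mem_sup.1 (hR hx)
  -- The component `w` is orthogonal to `V` but perhaps not to the new vectors `s f`. Adding this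
  -- `r` repairs that, and subtracting it from `v` stays inside `V`.
  let r : R := (Module.evalEquiv K R).symm ((B w) ∘ₗ s)
  have hr : ∀ f : R →ₗ[K] K, f r = B w (s f) := fun f =>
    Module.apply_evalEquiv_symm_apply (R := K) (M := R) f (B w ∘ₗ s)
  have hx2 : x = (s (C x) + (v - r)) + (w + r) := by
    have := eq_add_of_sub_eq' hvw.symm
    calc x = s (C x) + (v + w) := this
      _ = _ := by abel
  have hxx : s (C x) + (v - r) ∈ V ⊔ LinearMap.range s := by
    rw [add_comm]
    exact Submodule.add_mem_sup (V.sub_mem hv (hRV r.2)) ⟨_, rfl⟩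
  rw [hx2]
  refine Submodule.add_mem_sup hxx ?_
  intro y hy
  refine hB.isRefl _ _ ?_
  obtain ⟨v', hv', _, ⟨f, rfl⟩, rfl⟩ := Submodule.mem_sup.1 hy
  have h1 : B (w + r) v' = 0 := hB.isRefl _ _ (Submodule.add_mem _ hw (hRV' r.2) v' hv')
  have h2 : B r (s f) = - f r := by rw [← hs' f r, hB.neg]
  rw [map_add, h1, zero_add, map_add, LinearMap.add_apply, h2, hr f, add_neg_cancel]

theorem map_sup_orthogonal_eq_top {B : F →ₗ[K] F →ₗ[K] K} {e : F ≃ₗ[K] F}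
    (he : ∀ x y, B (e x) (e y) = B x y) {V : Submodule K F}
    (hV : V ⊔ V.orthogonalBilin B = ⊤) :
    V.map (e : F →ₗ[K] F) ⊔ (V.map (e : F →ₗ[K] F)).orthogonalBilin B = ⊤ := by
  rw [eq_top_iff]
  intro x _
  obtain ⟨v, hv, w, hw, h⟩ := Submodule.mem_sup.1 (hV ▸ Submodule.mem_top : e.symm x ∈ _)
  rw [← e.apply_symm_apply x, ← h, map_add]
  refine Submodule.add_mem_sup ⟨v, hv, rfl⟩ ?_
  rintro _ ⟨y, hy, rfl⟩
  exact (he y w).trans (hw y hy)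

end Alternating

/-! ## Truncation of Pauli operators -/

section Truncation

open Classical in
/-- The restriction of a Pauli operator to a region: the tensor factors outside are dropped. -/
def trunc (R : Set ℤ) : Pauli q →ₗ[ZMod 2] Pauli q where
  toFun P := Finsupp.filter (fun i => i.1 ∈ R) P
  map_add' _ _ := Finsupp.filter_add
  map_smul' _ _ := Finsupp.filter_smul

variable {R : Set ℤ}

theorem trunc_apply_of_mem (P : Pauli q) {i : Σ k : ℤ, Fin (q k)} (h : i.1 ∈ R) :
    trunc R P i = P i := by
  classical
  exact Finsupp.filter_apply_pos (fun i : Σ k : ℤ, Fin (q k) => i.1 ∈ R) P h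

theorem trunc_apply_of_notMem (P : Pauli q) {i : Σ k : ℤ, Fin (q k)} (h : i.1 ∉ R) :
    trunc R P i = 0 := by
  classical
  exact Finsupp.filter_apply_neg (fun i : Σ k : ℤ, Fin (q k) => i.1 ∈ R) P h

theorem apply_eq_zero_of_mem_pauliOn {P : Pauli q} (hP : P ∈ pauliOn q R)
    {i : Σ k : ℤ, Fin (q k)} (h : i.1 ∉ R) : P i = 0 := by
  by_contra h0
  exact h (hP ⟨i.2, h0⟩)

theorem trunc_mem_pauliOn_inter (P : Pauli q) {R' : Set ℤ} (hP : P ∈ pauliOn q R') :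
    trunc R P ∈ pauliOn q (R ∩ R') := by
  rintro k ⟨i, hi⟩
  by_cases h : k ∈ R
  · rw [trunc_apply_of_mem P h] at hi
    exact ⟨h, hP ⟨i, hi⟩⟩
  · exact absurd (trunc_apply_of_notMem P h) hi

theorem trunc_mem_pauliOn (R : Set ℤ) (P : Pauli q) : trunc R P ∈ pauliOn q R :=
  fun _ hk => (trunc_mem_pauliOn_inter P (R' := Set.univ) (fun _ _ => trivial) hk).1

theorem trunc_eq_self {P : Pauli q} (hP : P ∈ pauliOn q R) : trunc R P = P := by
  ext1 i
  by_cases h : i.1 ∈ R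
  · exact trunc_apply_of_mem P h
  · rw [trunc_apply_of_notMem P h, apply_eq_zero_of_mem_pauliOn hP h]

theorem trunc_eq_zero {P : Pauli q} {R' : Set ℤ} (hP : P ∈ pauliOn q R') (h : Disjoint R R') :
    trunc R P = 0 := by
  ext1 i
  by_cases hi : i.1 ∈ R
  · rw [trunc_apply_of_mem P hi]
    exact apply_eq_zero_of_mem_pauliOn hP (h.notMem_of_mem_left hi)
  · exact trunc_apply_of_notMem P hi

theorem trunc_union {R R' : Set ℤ} (h : Disjoint R R') (P : Pauli q) :
    trunc (R ∪ R') P = trunc R P + trunc R' P := by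
  ext1 i
  rw [Pauli.add_apply]
  by_cases h1 : i.1 ∈ R
  · rw [trunc_apply_of_mem P h1, trunc_apply_of_mem P (Or.inl h1),
      trunc_apply_of_notMem P (h.notMem_of_mem_left h1), add_zero]
  · by_cases h2 : i.1 ∈ R'
    · rw [trunc_apply_of_mem P h2, trunc_apply_of_mem P (Or.inr h2),
        trunc_apply_of_notMem P h1, zero_add]
    · rw [trunc_apply_of_notMem P h1, trunc_apply_of_notMem P h2,
        trunc_apply_of_notMem P (by simp [h1, h2]), zero_add]

/-- Truncation is self-adjoint because the form is a sum of independent terms over qubits. -/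
theorem commForm_trunc (P Q : Pauli q) :
    commForm q (trunc R P) Q = commForm q P (trunc R Q) := by
  change commFun q _ _ = commFun q _ _
  have h : (trunc R P).support ⊆ P.support := by
    intro i hi
    rw [Pauli.mem_support] at hi ⊢
    intro h0
    by_cases h : i.1 ∈ R
    · exact hi ((trunc_apply_of_mem P h).trans h0)
    · exact hi (trunc_apply_of_notMem P h)
  rw [commFun_eq h, commFun_eq subset_rfl]
  refine Finset.sum_congr rfl fun i _ => ?_
  by_cases h : i.1 ∈ R
  · rw [trunc_apply_of_mem P h, trunc_apply_of_mem Q h]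
  · rw [trunc_apply_of_notMem P h, trunc_apply_of_notMem Q h]
    simp

theorem commForm_isAlt : (commForm q).IsAlt := fun P => by
  change commFun q P P = 0
  refine Finset.sum_eq_zero fun i _ => ?_
  rw [mul_comm]
  exact CharTwo.add_self_eq_zero _

theorem commForm_eq_zero_of_mem {P Q : Pauli q} {R' : Set ℤ} (hP : P ∈ pauliOn q R)
    (hQ : Q ∈ pauliOn q R') (h : Disjoint R R') : commForm q P Q = 0 :=
  commForm_eq_zero_of_disjoint fun _ hk hk' => h.notMem_of_mem_left (hP hk) (hQ hk')

theorem pauliOn_mono {R' : Set ℤ} (h : R ⊆ R') : pauliOn q R ≤ pauliOn q R' :=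
  fun _ hP => Set.Subset.trans hP h

theorem Pauli.exists_siteSupport_subset (P : Pauli q) :
    ∃ n : ℕ, siteSupport P ⊆ Set.Ioo (-(n : ℤ)) n := by
  -- A crude bound: the sum exceeds the absolute value of every site in the support.
  refine ⟨∑ i ∈ P.support, (i.1.natAbs + 1), ?_⟩
  rintro k ⟨i, hi⟩
  have h := Finset.single_le_sum (f := fun i : Σ k : ℤ, Fin (q k) => i.1.natAbs + 1)
    (fun _ _ => Nat.zero_le _) (Pauli.mem_support.2 hi)
  simp only at h
  rw [Set.mem_Ioo]
  omega

/-- On a finite region, each linear functional is given by the commutation with an operator. -/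
theorem exists_commForm_eq (hR : R.Finite) (f : Pauli q →ₗ[ZMod 2] ZMod 2) :
    ∃ Y ∈ pauliOn q R, ∀ Z ∈ pauliOn q R, commForm q Z Y = f Z := by
  let U := pauliOn q R
  have : Finite U := finite_pauliOn hR
  obtain ⟨Y, hY⟩ := exists_eq_of_forall_eq_zero ((commForm q).domRestrict₁₂ U U)
    (f ∘ₗ U.subtype) (by
      rintro ⟨P, hP⟩ h
      suffices P = 0 by subst this; exact map_zero f
      ext1 i
      by_cases hi : i.1 ∈ R
      · have hs : ∀ p, Pauli.single i p ∈ U := by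
          rintro p k ⟨j, hj⟩
          by_contra hk
          refine hj (Finsupp.single_eq_of_ne ?_)
          rintro rfl
          exact hk hi
        have hc : ∀ p, commForm q (Pauli.single i p) P = p.1 * (P i).2 + p.2 * (P i).1 := by
          intro p
          change commFun q _ _ = _
          have hi : (Pauli.single i p).support ⊆ {i} := Finsupp.support_single_subset
          rw [commFun_eq hi, Finset.sum_singleton]
          have : Pauli.single i p i = p := Finsupp.single_eq_same
          rw [this]
        have h1 := (hc (1, 0)).symm.trans (h ⟨_, hs (1, 0)⟩)
        have h2 := (hc (0, 1)).symm.trans (h ⟨_, hs (0, 1)⟩)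
        refine Prod.ext ?_ ?_
        · simpa using h2
        · simpa using h1
      · exact apply_eq_zero_of_mem_pauliOn hP hi)
  refine ⟨Y, Y.2, fun Z hZ => ?_⟩
  rw [commForm_comm]
  exact LinearMap.congr_fun hY ⟨Z, hZ⟩

end Truncation

/-! ## The filtration of `F` -/

section Filtration

variable {L S : Submodule (ZMod 2) (Pauli q)}

theorem quotOn_mono {R R' : Set ℤ} (h : R ⊆ R') : quotOn L S R ≤ quotOn L S R' := fun x hx => by
  obtain ⟨P, hP, rfl⟩ := mem_quotOn.1 hx
  exact mem_quotOn.2 ⟨P, hP.trans h, rfl⟩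

theorem cls_sub (P Q : L) : cls S (P - Q) = cls S P - cls S Q := map_sub _ _ _

theorem cls_add (P Q : L) : cls S (P + Q) = cls S P + cls S Q := map_add _ _ _

variable (L S) in
/-- The quotient map onto `F`. -/
def toF : L →ₗ[ZMod 2] FSpace L S :=
  (quotNegInf L S ⊔ quotPosInf L S).mkQ ∘ₗ (S.submoduleOf L).mkQ

theorem toF_surjective : Function.Surjective (toF L S) :=
  (Submodule.mkQ_surjective _).comp (Submodule.mkQ_surjective _)

theorem toF_eq_zero_iff {P : L} : toF L S P = 0 ↔ cls S P ∈ quotNegInf L S ⊔ quotPosInf L S :=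
  Submodule.Quotient.mk_eq_zero _

theorem toF_eq_zero_of_mem {P : L} (hP : P.1 ∈ S) : toF L S P = 0 := by
  have : cls S P = 0 := (Submodule.Quotient.mk_eq_zero _).2 hP
  rw [toF_eq_zero_iff, this]
  exact zero_mem _

/-- The classes at `+∞` in the definition of `F_{<a}` already vanish in `F`. -/
theorem FLeft_eq (a : ℤ) :
    FLeft L S a = ((pauliOn q (Set.Iio a)).submoduleOf L).map (toF L S) := by
  rw [FLeft, toF, Submodule.map_comp, Submodule.map_sup]
  refine sup_eq_left.2 (le_trans ?_ bot_le)
  rintro _ ⟨x, hx, rfl⟩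
  exact (Submodule.Quotient.mk_eq_zero _).2 (Submodule.mem_sup_right hx)

theorem toF_mem_FLeft {P : L} {a : ℤ} (hP : siteSupport P.1 ⊆ Set.Iio a) :
    toF L S P ∈ FLeft L S a := by
  rw [FLeft_eq]
  exact ⟨P, hP, rfl⟩

theorem exists_of_mem_FLeft {x : FSpace L S} {a : ℤ} (hx : x ∈ FLeft L S a) :
    ∃ P : L, siteSupport P.1 ⊆ Set.Iio a ∧ toF L S P = x := by
  rw [FLeft_eq] at hx
  exact hx

theorem FLeft_mono : Monotone (FLeft L S) := fun a b h => by
  intro x hx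
  obtain ⟨P, hP, rfl⟩ := exists_of_mem_FLeft hx
  exact toF_mem_FLeft (hP.trans (Set.Iio_subset_Iio h))

theorem exists_mem_FLeft (x : FSpace L S) : ∃ a, x ∈ FLeft L S a := by
  obtain ⟨P, rfl⟩ := toF_surjective x
  obtain ⟨n, hn⟩ := P.1.exists_siteSupport_subset
  exact ⟨n, toF_mem_FLeft fun k hk => (hn hk).2⟩

theorem exists_le_FLeft (U : Submodule (ZMod 2) (FSpace L S)) [Module.Finite (ZMod 2) U] :
    ∃ a, U ≤ FLeft L S a := by
  choose f hf using exists_mem_FLeft (L := L) (S := S)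
  have : Finite U := Module.finite_of_finite (ZMod 2)
  obtain ⟨a, ha⟩ := (Set.finite_range fun u : U => f u.1).bddAbove
  refine ⟨a, fun u hu => ?_⟩
  have h : f u ≤ a := ha (Set.mem_range_self (⟨u, hu⟩ : U))
  exact FLeft_mono h (hf u)

/-- Modulo `F_{<a}`, an operator supported left of `b` matters only through its restriction to `[a,
b)`, which has finitely many possible values. -/
theorem finite_FLeft (a b : ℤ) :
    Module.Finite (ZMod 2) ((FLeft L S b).map (FLeft L S a).mkQ) := by
  let V := (pauliOn q (Set.Iio b)).submoduleOf L
  let g : V →ₗ[ZMod 2] Pauli q := trunc (Set.Ico a b) ∘ₗ L.subtype ∘ₗ V.subtype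
  have : Finite (LinearMap.range g) := by
    refine (finite_pauliOn (q := q) (Set.finite_Ico a b)).subset ?_
    rintro _ ⟨P, rfl⟩
    exact trunc_mem_pauliOn _ _
  have h : LinearMap.ker g ≤
      LinearMap.ker (((FLeft L S a).mkQ ∘ₗ toF L S) ∘ₗ V.subtype) := by
    intro P hP
    refine (Submodule.Quotient.mk_eq_zero _).2 (toF_mem_FLeft ?_)
    rintro k ⟨i, hi⟩
    have hkb : k < b := P.2 ⟨i, hi⟩
    by_contra hka
    refine hi ?_
    have := congrArg (fun Q : Pauli q => Q ⟨k, i⟩) (LinearMap.mem_ker.1 hP)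
    have hk : k ∈ Set.Ico a b := ⟨not_lt.1 hka, hkb⟩
    exact (trunc_apply_of_mem (i := ⟨k, i⟩) P.1.1 hk).symm.trans this
  have h' := finite_range_of_ker_le h
  rwa [LinearMap.range_comp, Submodule.range_subtype, Submodule.map_comp, ← FLeft_eq] at h'

end Filtration

/-! ## Automata whose inverses have finite range -/

namespace MQCA

variable {L S : Submodule (ZMod 2) (Pauli q)}

theorem bar_toF (α : MQCA L S) {P Q : L} (h : α.toEquiv (cls S P) = cls S Q) :
    α.bar (toF L S P) = toF L S Q :=
  congrArg (quotNegInf L S ⊔ quotPosInf L S).mkQ h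

/-- Every shift beyond the range is allowed, so that an automaton and its inverse can share one. -/
theorem exists_bar_FLeft_le (α : MQCA L S) :
    ∃ r : ℕ, ∀ a, ∀ s : ℤ, r ≤ s → (FLeft L S a).map α.bar ≤ FLeft L S (a + s) := by
  obtain ⟨r, hr⟩ := α.finite_range
  refine ⟨r, fun a s hs => ?_⟩
  rintro _ ⟨x, hx, rfl⟩
  obtain ⟨P, hP, rfl⟩ := exists_of_mem_FLeft hx
  obtain ⟨Q, hQ, hQs⟩ := hr P
  rw [α.bar_toF hQ]
  refine toF_mem_FLeft fun k hk => ?_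
  obtain ⟨j, hj, hkj⟩ := hQs hk
  have h1 : j < a := hP hj
  have h2 := abs_le.1 hkj
  rw [Set.mem_Iio]
  omega

theorem bar_bar_of_symm (α β : MQCA L S) (h : ∀ x, α.toEquiv (β.toEquiv x) = x)
    (x : FSpace L S) : α.bar (β.bar x) = x := by
  obtain ⟨P, rfl⟩ := toF_surjective x
  obtain ⟨r, hr⟩ := β.finite_range
  obtain ⟨Q, hQ, -⟩ := hr P
  rw [β.bar_toF hQ]
  exact α.bar_toF (hQ ▸ h _)

/-- If the inverse of `α` has finite range, `bar α` is invertible. -/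
def barEquiv (α β : MQCA L S) (h : β.toEquiv = α.toEquiv.symm) :
    FSpace L S ≃ₗ[ZMod 2] FSpace L S :=
  LinearEquiv.ofLinearMap α.bar β.bar
    (LinearMap.ext fun x => α.bar_bar_of_symm β (fun y => by simp [h]) x)
    (LinearMap.ext fun x => β.bar_bar_of_symm α (fun y => by simp [h]) x)

theorem barEquiv_coe (α β : MQCA L S) (h : β.toEquiv = α.toEquiv.symm) :
    (α.barEquiv β h : FSpace L S →ₗ[ZMod 2] FSpace L S) = α.bar := rfl

theorem isBetween_map_bar (α β : MQCA L S) (h : β.toEquiv = α.toEquiv.symm)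
    {V : Submodule (ZMod 2) (FSpace L S)} (hV : IsBetween (FLeft L S) V) :
    IsBetween (FLeft L S) (V.map α.bar) := by
  obtain ⟨r, hr⟩ := α.exists_bar_FLeft_le
  obtain ⟨s, hs⟩ := β.exists_bar_FLeft_le
  exact hV.map (e := α.barEquiv β h) (r := r + s) (fun a => hr a _ (by omega))
    (fun a => hs a _ (by omega))

/-- If the inverse of `α` has finite range, `α` has an index, and it can be computed from any
subspace that is bounded by the filtration of `F`. -/
theorem hasIndex_of_inverse (α β : MQCA L S) (h : β.toEquiv = α.toEquiv.symm)
    {V W : Submodule (ZMod 2) (FSpace L S)} (hV : IsBetween (FLeft L S) V)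
    (hW : IsBetween (FLeft L S) W) (hVW : V ≤ W) (hαW : V.map α.bar ≤ W) :
    α.HasIndex (((relDim V W - relDim (V.map α.bar) W : ℤ) : ℚ) / 2) := by
  obtain ⟨r, hr⟩ := α.exists_bar_FLeft_le
  obtain ⟨s, hs⟩ := β.exists_bar_FLeft_le
  intro a b F₀ ν _ ha hb hν
  have := fredholm_compression_of_isBetween (e := α.barEquiv β h) (r := r + s) FLeft_mono
    finite_FLeft (fun a => hr a _ (by omega)) (fun a => hs a _ (by omega)) hV hW hVW hαW
    ⟨a, b, ha, hb⟩ ν hν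
  exact ⟨this.1, by rw [← barEquiv_coe α β h, ← this.2]; rfl⟩

end MQCA

/-! ## Locally generated stabilizer groups -/

/-- Across each cut of the line, a stabilizer of `A` is a product of stabilizers that are supported
on the two sides of the cut or within distance `ℓ` of it. -/
def SplitsAcrossCuts (A : StabilizerGroup q) (ℓ : ℕ) : Prop :=
  ∀ a : ℤ, ∀ s ∈ A.group, ∃ s₁ ∈ A.group, ∃ c ∈ A.group, ∃ s₂ ∈ A.group, s = s₁ + c + s₂ ∧
    s₁ ∈ pauliOn q (Set.Iio a) ∧ c ∈ pauliOn q (Set.Icc (a - ℓ) (a + ℓ)) ∧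
      s₂ ∈ pauliOn q (Set.Ici a)

/-- Each local generator lies left of the cut, lies right of it, or straddles it and so stays within
distance `ℓ`. -/
theorem StabilizerGroup.LocallyGenerated.exists_splits {A : StabilizerGroup q}
    (hA : A.LocallyGenerated) : ∃ ℓ, SplitsAcrossCuts A ℓ := by
  obtain ⟨ℓ, G, hG, hspan⟩ := hA
  refine ⟨ℓ, fun a s hs => ?_⟩
  have hle : A.group ≤ (A.group ⊓ pauliOn q (Set.Iio a)) ⊔
      (A.group ⊓ pauliOn q (Set.Icc (a - ℓ) (a + ℓ))) ⊔ (A.group ⊓ pauliOn q (Set.Ici a)) := by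
    rw [← hspan, Submodule.span_le]
    intro g hg
    have hgA := Submodule.subset_span (R := ZMod 2) hg
    obtain ⟨k, hk⟩ := hG g hg
    by_cases h1 : k + ℓ < a
    · refine Submodule.mem_sup_left (Submodule.mem_sup_left ⟨hgA, fun m hm => ?_⟩)
      have := (hk hm).2
      rw [Set.mem_Iio]
      omega
    · by_cases h2 : a ≤ k
      · refine Submodule.mem_sup_right ⟨hgA, fun m hm => ?_⟩
        have := (hk hm).1
        rw [Set.mem_Ici]
        omega
      · refine Submodule.mem_sup_left (Submodule.mem_sup_right ⟨hgA, fun m hm => ?_⟩)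
        have := hk hm
        rw [Set.mem_Icc] at this ⊢
        omega
  obtain ⟨x, hx, s₂, h₂, rfl⟩ := Submodule.mem_sup.1 (hle hs)
  obtain ⟨s₁, h₁, c, hc, rfl⟩ := Submodule.mem_sup.1 hx
  exact ⟨s₁, h₁.1, c, hc.1, s₂, h₂.1, rfl, h₁.2, hc.2, h₂.2⟩

theorem disjoint_Iio_Ici {a b : ℤ} (h : a ≤ b) : Disjoint (Set.Iio a) (Set.Ici b) :=
  Set.disjoint_left.2 fun _ h1 h2 => absurd (lt_of_lt_of_le h1 h) (not_lt.2 h2)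

/-- A stabilizer, truncated to the left of a cut, is a stabilizer up to an operator near the cut. -/
theorem SplitsAcrossCuts.exists_trunc_eq {A : StabilizerGroup q} {ℓ : ℕ}
    (hA : SplitsAcrossCuts A ℓ) (a : ℤ) {s : Pauli q} (hs : s ∈ A.group) :
    ∃ s₁ ∈ A.group, ∃ c ∈ A.group, s₁ ∈ pauliOn q (Set.Iio a) ∧
      trunc (Set.Iio a) s = s₁ + trunc (Set.Iio a) c ∧
        trunc (Set.Iio a) c ∈ pauliOn q (Set.Icc (a - ℓ) (a + ℓ)) := by
  obtain ⟨s₁, h₁, c, hc, s₂, -, rfl, h₁', hc', h₂'⟩ := hA a s hs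
  refine ⟨s₁, h₁, c, hc, h₁', ?_,
    pauliOn_mono Set.inter_subset_right (trunc_mem_pauliOn_inter c hc')⟩
  rw [map_add, map_add, trunc_eq_self h₁', trunc_eq_zero h₂' (disjoint_Iio_Ici le_rfl), add_zero]

/-! ### The radical of the commutation form, and orthogonal summands of `F` -/

namespace StabilizerGroup

variable (A : StabilizerGroup q)

theorem finite_cls_pauliOn {R : Set ℤ} (hR : R.Finite) :
    ((cls A.group) '' {P : A.logicals | P.1 ∈ pauliOn q R}).Finite :=
  ((finite_pauliOn hR).preimage Subtype.val_injective.injOn).image _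

variable {A}

/-- An operator that commutes with all logical operators agrees with a stabilizer on each finite
region that contains its support. -/
theorem exists_trunc_eq_of_commute {R : Set ℤ} (hR : R.Finite) {P : Pauli q}
    (hP : P ∈ pauliOn q R) (h : ∀ Y ∈ A.logicals, commForm q P Y = 0) :
    ∃ s ∈ A.group, trunc R s = P := by
  by_contra hno
  have hPT : P ∉ A.group.map (trunc R) := hno
  -- A functional separating `P` from the truncated stabilizers is commutation with some `Y` on `R`.
  -- This `Y` commutes with all stabilizers, so it is a logical operator that fails to commute with
  -- `P`.
  obtain ⟨f, hf, hle⟩ := Submodule.exists_le_ker_of_notMem hPT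
  obtain ⟨Y, hY, hYf⟩ := exists_commForm_eq hR f
  refine hf ?_
  rw [← hYf P hP]
  refine h Y fun s hs => ?_
  rw [commForm_comm, ← trunc_eq_self hY, ← commForm_trunc, hYf _ (trunc_mem_pauliOn R s)]
  exact hle ⟨s, hs, rfl⟩

/-- An operator that commutes with all logical operators is a product of a stabilizer and of
logical operators far to the left and far to the right. -/
theorem exists_cls_eq_add_of_commute {ℓ : ℕ} (hA : SplitsAcrossCuts A ℓ) (P : A.logicals)
    (h : ∀ Y ∈ A.logicals, commForm q P Y = 0) :
    ∃ M : ℕ, ∀ N : ℕ, M ≤ N → ∃ x ∈ quotOn A.logicals A.group (Set.Iio (-N)),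
      cls A.group P - x ∈ quotOn A.logicals A.group (Set.Ici N) := by
  obtain ⟨n, hn⟩ := P.1.exists_siteSupport_subset
  -- The window `[-N, N)` must contain the support of `P`, and what lies outside must avoid the
  -- stabilizers within distance `ℓ` of the cut at `0`.
  refine ⟨max n (ℓ + 1), fun N hN => ?_⟩
  have hnN : n ≤ N := (le_max_left _ _).trans hN
  have hℓN : ℓ + 1 ≤ N := (le_max_right _ _).trans hN
  obtain ⟨s, hs, hsP⟩ := exists_trunc_eq_of_commute (A := A) (Set.finite_Ico (-(N : ℤ)) N)
    (P := P.1) (fun k hk => by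
      have := hn hk
      rw [Set.mem_Ioo] at this
      rw [Set.mem_Ico]
      omega) h
  set u := trunc (Set.Iio (-(N : ℤ))) s with hu
  set v := trunc (Set.Ici (N : ℤ)) s with hv
  have huN : u ∈ pauliOn q (Set.Iio (-(N : ℤ))) := trunc_mem_pauliOn _ _
  have hvN : v ∈ pauliOn q (Set.Ici (N : ℤ)) := trunc_mem_pauliOn _ _
  have hdec : s = u + P.1 + v := by
    have h1 : Set.Iio (-(N : ℤ)) ∪ Set.Ico (-(N : ℤ)) N ∪ Set.Ici (N : ℤ) = Set.univ := by
      ext k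
      simp only [Set.mem_union, Set.mem_Iio, Set.mem_Ico, Set.mem_Ici, Set.mem_univ, iff_true]
      omega
    rw [← hsP, hu, hv, ← trunc_union, ← trunc_union, h1]
    · exact (trunc_eq_self fun _ _ => trivial).symm
    · refine Set.disjoint_left.2 fun k h1 h2 => ?_
      simp only [Set.mem_union, Set.mem_Iio, Set.mem_Ico, Set.mem_Ici] at h1 h2
      omega
    · refine Set.disjoint_left.2 fun k h1 h2 => ?_
      simp only [Set.mem_Iio, Set.mem_Ico] at h1 h2
      omega
  -- Split a stabilizer at the cut `0`. On the left part `v` has no support while `s` and `P`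
  -- commute with it, hence so does `u`; the other two parts are disjoint from `u`.
  have huA : u ∈ A.logicals := by
    intro t ht
    obtain ⟨t₁, h₁, c, hc, t₂, h₂, rfl, h₁', hc', h₂'⟩ := hA 0 t ht
    have e1 : commForm q u t₁ = 0 := by
      have e := A.abelian s hs t₁ h₁
      rwa [hdec, map_add, map_add, LinearMap.add_apply, LinearMap.add_apply, P.2 t₁ h₁,
        commForm_eq_zero_of_mem hvN h₁' (disjoint_Iio_Ici (by omega)).symm, add_zero,
        add_zero] at e
    have e2 : commForm q u c = 0 := by
      refine commForm_eq_zero_of_mem huN hc' (Set.disjoint_left.2 fun k h1 h2 => ?_)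
      simp only [Set.mem_Iio, Set.mem_Icc] at h1 h2
      omega
    have e3 : commForm q u t₂ = 0 :=
      commForm_eq_zero_of_mem huN h₂' (disjoint_Iio_Ici (by omega))
    rw [map_add, map_add, e1, e2, e3, add_zero, add_zero]
  have hvA : v ∈ A.logicals := by
    have : v = s - u - P.1 := by rw [hdec]; abel
    rw [this]
    exact Submodule.sub_mem _ (Submodule.sub_mem _ (A.group_le_logicals hs) huA) P.2
  have hu' : -u ∈ pauliOn q (Set.Iio (-(N : ℤ))) := Submodule.neg_mem _ huN
  have hv' : -v ∈ pauliOn q (Set.Ici (N : ℤ)) := Submodule.neg_mem _ hvN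
  let u' : A.logicals := ⟨-u, Submodule.neg_mem _ huA⟩
  let v' : A.logicals := ⟨-v, Submodule.neg_mem _ hvA⟩
  refine ⟨cls A.group u', mem_quotOn.2 ⟨u', hu', rfl⟩, mem_quotOn.2 ⟨v', hv', ?_⟩⟩
  rw [← cls_sub, cls_eq_cls]
  have : -v - (P.1 - -u) = -s := by
    rw [hdec]
    abel
  exact (congrArg (· ∈ A.group) this).mpr (Submodule.neg_mem _ hs)

/-- Only finitely many classes are represented on both sides of a cut. -/
theorem finite_quotOn_inf {ℓ : ℕ} (hA : SplitsAcrossCuts A ℓ) (a : ℤ) :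
    (quotOn A.logicals A.group (Set.Iio a) ⊓ quotOn A.logicals A.group (Set.Ici a) :
      Set A.Logical).Finite := by
  refine (A.finite_cls_pauliOn (Set.finite_Icc (a - ℓ) (a + ℓ))).subset ?_
  rintro x ⟨hx, hx'⟩
  obtain ⟨P, hP, rfl⟩ := mem_quotOn.1 hx
  obtain ⟨Q, hQ, hPQ⟩ := mem_quotOn.1 hx'
  -- `P - Q` is a stabilizer whose left truncation is `P`. Removing the stabilizer `s₁` leaves a
  -- representative of the same class near the cut.
  obtain ⟨s₁, h₁, c, -, -, h, hc⟩ := hA.exists_trunc_eq a (cls_eq_cls.1 hPQ.symm)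
  rw [map_sub, trunc_eq_self hP, trunc_eq_zero hQ (disjoint_Iio_Ici le_rfl), sub_zero] at h
  have hc' : trunc (Set.Iio a) c = P.1 - s₁ := by rw [h, add_sub_cancel_left]
  rw [hc'] at hc
  refine ⟨⟨P.1 - s₁, Submodule.sub_mem _ P.2 (A.group_le_logicals h₁)⟩, hc, ?_⟩
  rw [cls_eq_cls]
  simpa using h₁

/-- The class of an operator that commutes with all logical operators is a product of classes at
infinity. -/
theorem cls_mem_infinity_of_commute {ℓ : ℕ} (hA : SplitsAcrossCuts A ℓ) (P : A.logicals)
    (h : ∀ Y ∈ A.logicals, commForm q P Y = 0) :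
    cls A.group P ∈ quotNegInf A.logicals A.group ⊔ quotPosInf A.logicals A.group := by
  obtain ⟨M, hM⟩ := exists_cls_eq_add_of_commute hA P h
  have hM' : ∀ n : ℕ, ∃ x ∈ quotOn A.logicals A.group (Set.Iio (-(M + n : ℕ))),
      cls A.group P - x ∈ quotOn A.logicals A.group (Set.Ici (M + n : ℕ)) :=
    fun n => hM _ (Nat.le_add_right _ _)
  choose x hx hx' using hM'
  have hleft : ∀ n, x n ∈ quotOn A.logicals A.group (Set.Iio 0) := fun n =>
    quotOn_mono (Set.Iio_subset_Iio (by omega)) (hx n)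
  have hright : ∀ n, cls A.group P - x n ∈ quotOn A.logicals A.group (Set.Ici 0) := fun n =>
    quotOn_mono (Set.Ici_subset_Ici.2 (by omega)) (hx' n)
  have := (finite_quotOn_inf hA 0).to_subtype
  -- The differences `x n - x 0` are represented on both sides of `0`, so they take finitely many
  -- values and one value recurs infinitely often. The corresponding constant class `x n` is then
  -- represented arbitrarily far left, and its complement in `cls P` arbitrarily far right.
  obtain ⟨⟨y, hy⟩, hinf⟩ := Finite.exists_infinite_fiber
    (fun n : ℕ => (⟨x n - x 0, Submodule.sub_mem _ (hleft n) (hleft 0), by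
      have := Submodule.sub_mem _ (hright 0) (hright n)
      rwa [sub_sub_sub_cancel_left] at this⟩ :
      (quotOn A.logicals A.group (Set.Iio 0) ⊓ quotOn A.logicals A.group (Set.Ici 0) :
        Set A.Logical)))
  have hbig : ∀ m : ℕ, ∃ n, m < n ∧ x n = y + x 0 := by
    intro m
    obtain ⟨n, hn, hmn⟩ := (Set.infinite_coe_iff.1 hinf).exists_gt m
    exact ⟨n, hmn, sub_eq_iff_eq_add.1 (congrArg Subtype.val hn)⟩
  rw [← add_sub_cancel (y + x 0) (cls A.group P)]
  refine Submodule.add_mem_sup ((Submodule.mem_iInf _).2 fun k => ?_)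
    ((Submodule.mem_iInf _).2 fun k => ?_)
  · obtain ⟨n, hn, hxn⟩ := hbig k.natAbs
    rw [← hxn]
    exact quotOn_mono (Set.Iio_subset_Iio (by omega)) (hx n)
  · obtain ⟨n, hn, hxn⟩ := hbig k.natAbs
    rw [← hxn]
    refine quotOn_mono (fun m hm => ?_) (hx' n)
    rw [Set.mem_Ici] at hm
    rw [Set.mem_Ioi]
    omega

/-- Representatives of classes at infinity can be moved off the support of `Y`, and changing them by
stabilizers does not affect commutation with `Y`. -/
theorem commute_of_cls_mem_infinity {P : A.logicals}
    (hP : cls A.group P ∈ quotNegInf A.logicals A.group ⊔ quotPosInf A.logicals A.group)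
    {Y : Pauli q} (hY : Y ∈ A.logicals) : commForm q P Y = 0 := by
  obtain ⟨n, hn⟩ := Y.exists_siteSupport_subset
  obtain ⟨x, hx, y, hy, hxy⟩ := Submodule.mem_sup.1 hP
  obtain ⟨Q, hQ, rfl⟩ := mem_quotOn.1 ((Submodule.mem_iInf _).1 hx (-(n : ℤ)))
  obtain ⟨Q', hQ', rfl⟩ := mem_quotOn.1 ((Submodule.mem_iInf _).1 hy (n : ℤ))
  rw [← cls_add, cls_eq_cls] at hxy
  have h1 : commForm q Q Y = 0 := commForm_eq_zero_of_mem hQ hn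
    (Set.disjoint_left.2 fun k h1 h2 => by
      simp only [Set.mem_Iio, Set.mem_Ioo] at h1 h2
      omega)
  have h2 : commForm q Q' Y = 0 := commForm_eq_zero_of_mem hQ' hn
    (Set.disjoint_left.2 fun k h1 h2 => by
      simp only [Set.mem_Ioi, Set.mem_Ioo] at h1 h2
      omega)
  have h3 := hY _ hxy
  rw [commForm_comm] at h3
  simpa [h1, h2] using h3

theorem toF_eq_zero_iff_commute {ℓ : ℕ} (hA : SplitsAcrossCuts A ℓ) {P : A.logicals} :
    toF A.logicals A.group P = 0 ↔ ∀ Y ∈ A.logicals, commForm q P Y = 0 := by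
  rw [toF_eq_zero_iff]
  exact ⟨fun h Y hY => commute_of_cls_mem_infinity h hY, cls_mem_infinity_of_commute hA P⟩

/-- The commutation form descends to a nondegenerate form on `F`. -/
theorem exists_form {ℓ : ℕ} (hA : SplitsAcrossCuts A ℓ) :
    ∃ B : FSpace A.logicals A.group →ₗ[ZMod 2] FSpace A.logicals A.group →ₗ[ZMod 2] ZMod 2,
      (∀ P Q, B (toF _ _ P) (toF _ _ Q) = commForm q P.1 Q.1) ∧ B.IsAlt ∧
        ∀ x, (∀ y, B x y = 0) → x = 0 := by
  obtain ⟨s, hs⟩ := (toF A.logicals A.group).exists_rightInverse_of_surjective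
    (LinearMap.range_eq_top.2 toF_surjective)
  have hs' : ∀ x, toF A.logicals A.group (s x) = x := LinearMap.congr_fun hs
  let B := ((commForm q).domRestrict₁₂ A.logicals A.logicals).compl₁₂ s s
  have hker : ∀ (P : A.logicals) (Y : A.logicals),
      commForm q (s (toF _ _ P)).1 Y.1 = commForm q P.1 Y.1 := by
    intro P Y
    have := (toF_eq_zero_iff_commute hA (P := s (toF _ _ P) - P)).1
      (by rw [map_sub, hs', sub_self]) Y.1 Y.2
    rw [Submodule.coe_sub, map_sub, LinearMap.sub_apply] at this
    exact sub_eq_zero.1 this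
  have hB : ∀ P Q, B (toF _ _ P) (toF _ _ Q) = commForm q P.1 Q.1 := by
    intro P Q
    change commForm q (s (toF _ _ P)).1 (s (toF _ _ Q)).1 = _
    rw [hker, commForm_comm, hker, commForm_comm]
  refine ⟨B, hB, fun x => commForm_isAlt _, fun x hx => ?_⟩
  obtain ⟨P, rfl⟩ := toF_surjective x
  refine (toF_eq_zero_iff_commute hA).2 fun Y hY => ?_
  rw [← hB P ⟨Y, hY⟩]
  exact hx _

/-- For each site `a`, some orthogonal summand of `F` lies between `F_{<a}` and some `F_{<b}`. -/
theorem exists_orthogonal_summand {ℓ : ℕ} (hA : SplitsAcrossCuts A ℓ)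
    {B : FSpace A.logicals A.group →ₗ[ZMod 2] FSpace A.logicals A.group →ₗ[ZMod 2] ZMod 2}
    (hB : ∀ P Q, B (toF _ _ P) (toF _ _ Q) = commForm q P.1 Q.1) (hB' : B.IsAlt)
    (hB'' : ∀ x, (∀ y, B x y = 0) → x = 0) (a : ℤ) :
    ∃ V, FLeft A.logicals A.group a ≤ V ∧ IsBetween (FLeft A.logicals A.group) V ∧
      V ⊔ V.orthogonalBilin B = ⊤ := by
  let τ : Pauli q →ₗ[ZMod 2] Pauli q := trunc (Set.Iio a)
  let T := A.group.map τ
  have hT : ∀ t ∈ T, t ∈ pauliOn q (Set.Iio a) := by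
    rintro _ ⟨s, -, rfl⟩
    exact trunc_mem_pauliOn _ _
  -- truncated stabilizers commute with the logical operators on the left
  have hTL : ∀ t ∈ T, ∀ Y ∈ A.logicals, Y ∈ pauliOn q (Set.Iio a) → commForm q t Y = 0 := by
    rintro _ ⟨s, hs, rfl⟩ Y hY hYa
    rw [commForm_trunc, trunc_eq_self hYa, commForm_comm]
    exact hY s hs
  -- an operator on the left is logical if it commutes with the truncated stabilizers
  have hmem : ∀ m ∈ pauliOn q (Set.Iio a), (∀ t ∈ T, commForm q m t = 0) → m ∈ A.logicals := by
    intro m hm h s hs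
    rw [← trunc_eq_self hm, commForm_trunc]
    exact h _ ⟨s, hs, rfl⟩
  -- A truncated stabilizer can be moved near the cut by a true stabilizer that commutes with all of
  -- `T`. This is the source of both finiteness statements below.
  have hdec : ∀ t ∈ T, ∃ s₁ ∈ A.group, (∀ u ∈ T, commForm q s₁ u = 0) ∧ t - s₁ ∈ T ∧
      t - s₁ ∈ pauliOn q (Set.Icc (a - ℓ) (a + ℓ)) := by
    rintro _ ⟨s, hs, rfl⟩
    obtain ⟨s₁, h₁, c, hcA, h₁', h, hc⟩ := hA.exists_trunc_eq a hs
    have hc' : τ s - s₁ = trunc (Set.Iio a) c := by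
      change trunc (Set.Iio a) s - s₁ = _
      rw [h, add_sub_cancel_left]
    refine ⟨s₁, h₁, ?_, ?_, hc' ▸ hc⟩
    · rintro _ ⟨s', hs', rfl⟩
      rw [← commForm_trunc, trunc_eq_self h₁']
      exact A.abelian _ h₁ _ hs'
    · rw [hc']
      exact ⟨c, hcA, rfl⟩
  -- The truncated stabilizers that commute with `T` are logical operators by `hmem`. Their classes
  -- form the radical `R` for `exists_sup_orthogonal_eq_top`.
  let T₀ := (T ⊓ T.orthogonalBilin (commForm q)).submoduleOf A.logicals
  let R := T₀.map (toF A.logicals A.group)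
  have hRfin : Finite R := by
    refine Set.Finite.subset (((A.finite_cls_pauliOn (Set.finite_Icc (a - ℓ) (a + ℓ)))).image
      (quotNegInf A.logicals A.group ⊔ quotPosInf A.logicals A.group).mkQ) ?_
    rintro _ ⟨P, hP, rfl⟩
    obtain ⟨s₁, h₁, -, -, hc⟩ := hdec P.1 hP.1
    let s : A.logicals := ⟨s₁, A.group_le_logicals h₁⟩
    refine ⟨_, ⟨P - s, hc, rfl⟩, ?_⟩
    change toF _ _ (P - s) = _
    rw [map_sub, toF_eq_zero_of_mem (P := s) h₁, sub_zero]
  have hRV : R ≤ FLeft A.logicals A.group a := by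
    rintro _ ⟨P, hP, rfl⟩
    exact toF_mem_FLeft (hT _ hP.1)
  have hRV' : R ≤ (FLeft A.logicals A.group a).orthogonalBilin B := by
    rintro _ ⟨P, hP, rfl⟩ x hx
    obtain ⟨Y, hY, rfl⟩ := exists_of_mem_FLeft hx
    rw [hB, commForm_comm]
    exact hTL _ hP.1 Y.1 Y.2 hY
  have hR : R.orthogonalBilin B ≤
      FLeft A.logicals A.group a ⊔ (FLeft A.logicals A.group a).orthogonalBilin B := by
    intro x hx
    obtain ⟨P, rfl⟩ := toF_surjective x
    let BT := (commForm q).domRestrict₁₂ T T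
    have : Finite (LinearMap.range BT) := by
      refine Set.Finite.subset (((finite_pauliOn (q := q)
        (Set.finite_Icc (a - ℓ) (a + ℓ))).preimage
          (Subtype.val_injective (p := (· ∈ T))).injOn).image BT) ?_
      rintro _ ⟨t, rfl⟩
      obtain ⟨s₁, -, h₁, hcT, hc⟩ := hdec t.1 t.2
      refine ⟨⟨t.1 - s₁, hcT⟩, hc, LinearMap.ext fun u => ?_⟩
      change commForm q (t.1 - s₁) u.1 = commForm q t.1 u.1
      rw [map_sub, LinearMap.sub_apply, h₁ u.1 u.2, sub_zero]
    -- Truncating `P` may break commutation with `T`, and `d ∈ T` corrects this. It exists because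
    -- commutation with `P` vanishes on the radical of `BT`, whose classes lie in `R`. As `d`
    -- commutes with the logical operators on the left, `P - (τ P - d)` is orthogonal to `F_{<a}`.
    obtain ⟨d, hd⟩ := exists_eq_of_forall_eq_zero BT (commForm q P.1 ∘ₗ T.subtype) (by
      intro t ht
      have htT : t.1 ∈ T.orthogonalBilin (commForm q) := fun u hu => ht ⟨u, hu⟩
      have htL : t.1 ∈ A.logicals := hmem _ (hT _ t.2) fun u hu => by
        rw [commForm_comm]
        exact htT u hu
      have := hx _ ⟨⟨t.1, htL⟩, ⟨t.2, htT⟩, rfl⟩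
      rw [hB, commForm_comm] at this
      exact this)
    have hd' : ∀ t ∈ T, commForm q d t = commForm q P t := fun t ht =>
      LinearMap.congr_fun hd ⟨t, ht⟩
    have hm : τ P - d ∈ pauliOn q (Set.Iio a) :=
      Submodule.sub_mem _ (trunc_mem_pauliOn _ _) (hT _ d.2)
    have hmL : τ P - d ∈ A.logicals := hmem _ hm fun t ht => by
      rw [map_sub, LinearMap.sub_apply, hd' t ht, commForm_trunc, trunc_eq_self (hT t ht),
        sub_self]
    rw [← add_sub_cancel (⟨_, hmL⟩ : A.logicals) P, map_add]
    refine Submodule.add_mem_sup (toF_mem_FLeft hm) fun y hy => ?_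
    obtain ⟨Y, hY, rfl⟩ := exists_of_mem_FLeft hy
    rw [hB, commForm_comm]
    change commForm q (P.1 - (τ P - d)) Y = 0
    rw [map_sub, map_sub, LinearMap.sub_apply, LinearMap.sub_apply, hTL _ d.2 Y.1 Y.2 hY,
      commForm_trunc, trunc_eq_self hY, sub_zero, sub_self]
  obtain ⟨R', hR', htop⟩ := exists_sup_orthogonal_eq_top hB' hB'' hRV hRV' hR
  obtain ⟨b, hb⟩ := exists_le_FLeft R'
  refine ⟨_, le_sup_left, ⟨a, max a b, le_sup_left, sup_le (FLeft_mono (le_max_left _ _))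
    (hb.trans (FLeft_mono (le_max_right _ _)))⟩, htop⟩

end StabilizerGroup

/-! ## Isometric automata -/

/-- An automaton on the logical operators of a locally generated stabilizer group, whose inverse has
finite range and which preserves commutation, has an integral index. -/
theorem MQCA.exists_int_hasIndex {A : StabilizerGroup q} (hA : A.LocallyGenerated)
    (α β : MQCA A.logicals A.group) (h : β.toEquiv = α.toEquiv.symm)
    (hα : ∀ P P' Q Q' : A.logicals, α.toEquiv (cls _ P) = cls _ Q →
      α.toEquiv (cls _ P') = cls _ Q' → commForm q Q Q' = commForm q P P') :
    ∃ n : ℤ, α.HasIndex n := by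
  obtain ⟨ℓ, hℓ⟩ := hA.exists_splits
  obtain ⟨B, hB, hB', hB''⟩ := StabilizerGroup.exists_form hℓ
  have hiso : ∀ x y, B (α.barEquiv β h x) (α.barEquiv β h y) = B x y := by
    intro x y
    obtain ⟨P, rfl⟩ := toF_surjective x
    obtain ⟨P', rfl⟩ := toF_surjective y
    obtain ⟨r, hr⟩ := α.finite_range
    obtain ⟨Q, hQ, -⟩ := hr P
    obtain ⟨Q', hQ', -⟩ := hr P'
    have e : ∀ z, α.barEquiv β h z = α.bar z := fun _ => rfl
    rw [e, e, α.bar_toF hQ, α.bar_toF hQ', hB, hB, hα _ _ _ _ hQ hQ']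
  obtain ⟨V, -, hV, hVtop⟩ := StabilizerGroup.exists_orthogonal_summand hℓ hB hB' hB'' 0
  have hαV := α.isBetween_map_bar β h hV
  obtain ⟨-, b, -, hb⟩ := id hV
  obtain ⟨-, c, -, hc⟩ := id hαV
  -- A summand beyond both upper bounds contains `V` and its image.
  obtain ⟨W, hW', hW, hWtop⟩ :=
    StabilizerGroup.exists_orthogonal_summand hℓ hB hB' hB'' (max b c)
  have hVW : V ≤ W := (hb.trans (FLeft_mono (le_max_left _ _))).trans hW'
  have hαW : V.map α.bar ≤ W := (hc.trans (FLeft_mono (le_max_right _ _))).trans hW'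
  have := hV.finite finite_FLeft hW
  have := hαV.finite finite_FLeft hW
  obtain ⟨m, hm⟩ := even_relDim hB' hB'' hVW hVtop hWtop
  obtain ⟨n, hn⟩ := even_relDim hB' hB'' hαW (map_sup_orthogonal_eq_top hiso hVtop) hWtop
  refine ⟨m - n, ?_⟩
  have := α.hasIndex_of_inverse β h hV hW hVW hαW
  rw [hm, hn] at this
  convert this using 1
  push_cast
  ring

/-! ## The index of a circuit -/

theorem nbhd_trans {r s : ℕ} {R R' R'' : Set ℤ} (h : R ⊆ nbhd r R') (h' : R' ⊆ nbhd s R'') :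
    R ⊆ nbhd (r + s) R'' := by
  intro k hk
  obtain ⟨m, hm, hkm⟩ := h hk
  obtain ⟨j, hj, hmj⟩ := h' hm
  have e1 := abs_le.1 hkm
  have e2 := abs_le.1 hmj
  exact ⟨j, hj, abs_le.2 ⟨by push_cast; omega, by push_cast; omega⟩⟩

theorem StabilizerGroup.commForm_eq_of_cls_eq (A : StabilizerGroup q) {P P' Q Q' : A.logicals}
    (h : cls A.group P = cls A.group P') (h' : cls A.group Q = cls A.group Q') :
    commForm q P Q = commForm q P' Q' := by
  have h1 := Q.2 _ (cls_eq_cls.1 h)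
  have h2 := P'.2 _ (cls_eq_cls.1 h')
  rw [commForm_comm, map_sub, LinearMap.sub_apply, sub_eq_zero] at h1
  rw [map_sub, sub_eq_zero] at h2
  rw [h1, h2]

/-- Commutation depends only on classes, and common representatives are left unchanged by the
transition. -/
theorem LocallyReversible.commForm_transition {A B : StabilizerGroup q}
    (h : LocallyReversible A B) {P P' : A.logicals} {Q Q' : B.logicals}
    (hP : h.transition (cls A.group P) = cls B.group Q)
    (hP' : h.transition (cls A.group P') = cls B.group Q') :
    commForm q Q Q' = commForm q P P' := by
  obtain ⟨⟨X, hXA, hXB⟩, hX⟩ := h.surjective_left (cls A.group P)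
  obtain ⟨⟨X', hXA', hXB'⟩, hX'⟩ := h.surjective_left (cls A.group P')
  have e : cls A.group ⟨X, hXA⟩ = cls A.group P := hX
  have e' : cls A.group ⟨X', hXA'⟩ = cls A.group P' := hX'
  rw [← e, h.transition_cls X hXA hXB] at hP
  rw [← e', h.transition_cls X' hXA' hXB'] at hP'
  rw [← A.commForm_eq_of_cls_eq e e', ← B.commForm_eq_of_cls_eq hP hP']

namespace PLRMC

/-- Finite range of the inverse evolution: local reversibility is symmetric, so every step can be
undone with bounded spreading. -/
theorem evolution_surjective_range (C : PLRMC q) (t : ℕ) (h : t ≤ C.T) :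
    ∃ r : ℕ, ∀ Q : (C.A t).logicals, ∃ P : (C.A 0).logicals,
      C.evolution t h (cls _ P) = cls _ Q ∧ siteSupport P.1 ⊆ nbhd r (siteSupport Q.1) := by
  induction t with
  | zero => exact ⟨0, fun P => ⟨P, rfl, fun k hk => ⟨k, hk, by simp⟩⟩⟩
  | succ t ih =>
    obtain ⟨r, hr⟩ := ih (Nat.le_of_succ_le h)
    obtain ⟨s, hs⟩ := (C.reversible t h).symm.exists_common
    refine ⟨r + s, fun Q => ?_⟩
    obtain ⟨b, hb, hA, hbs⟩ := hs Q.1 Q.2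
    have hB : Q.1 + b ∈ (C.A (t + 1)).logicals :=
      Submodule.add_mem _ Q.2 ((C.A (t + 1)).group_le_logicals hb)
    obtain ⟨P, hP, hPr⟩ := hr ⟨Q.1 + b, hA⟩
    refine ⟨P, ?_, nbhd_trans hPr hbs⟩
    have e : cls (C.A (t + 1)).group ⟨Q.1 + b, hB⟩ = cls (C.A (t + 1)).group Q := by
      rw [cls_eq_cls]
      simpa using hb
    rw [← e, ← (C.reversible t h).transition_cls _ hA hB, ← hP]
    rfl

theorem commForm_evolution (C : PLRMC q) (t : ℕ) (h : t ≤ C.T) {P P' : (C.A 0).logicals}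
    {Q Q' : (C.A t).logicals} (hQ : C.evolution t h (cls _ P) = cls _ Q)
    (hQ' : C.evolution t h (cls _ P') = cls _ Q') : commForm q Q Q' = commForm q P P' := by
  induction t with
  | zero => exact ((C.A 0).commForm_eq_of_cls_eq hQ hQ').symm
  | succ t ih =>
    obtain ⟨r, hr⟩ := C.evolution_range t (Nat.le_of_succ_le h)
    obtain ⟨R, hR, -⟩ := hr P
    obtain ⟨R', hR', -⟩ := hr P'
    rw [← ih (Nat.le_of_succ_le h) hR hR']
    refine (C.reversible t h).commForm_transition ?_ ?_
    · rw [← hR, ← hQ]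
      rfl
    · rw [← hR', ← hQ']
      rfl

theorem canonicalMQCA_cls_iff (C : PLRMC q) {P Q : (C.A 0).logicals} :
    C.canonicalMQCA.toEquiv (cls _ P) = cls _ Q ↔
      C.evolution C.T le_rfl (cls _ P) = cls _ ⟨Q.1, C.periodic.symm ▸ Q.2⟩ := by
  have h : C.canonicalMQCA.toEquiv (cls _ P) =
      logicalOfEq C.periodic (C.evolution C.T le_rfl (cls _ P)) := rfl
  rw [h, ← (logicalOfEq C.periodic).injective.eq_iff, logicalOfEq_cls]

/-- The inverse of the canonical automaton. -/
def inverseMQCA (C : PLRMC q) : MQCA (C.A 0).logicals (C.A 0).group where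
  toEquiv := C.canonicalMQCA.toEquiv.symm
  finite_range := by
    obtain ⟨r, hr⟩ := C.evolution_surjective_range C.T le_rfl
    refine ⟨r, fun Q => ?_⟩
    obtain ⟨P, hP, hs⟩ := hr ⟨Q.1, C.periodic.symm ▸ Q.2⟩
    exact ⟨P, (LinearEquiv.symm_apply_eq _).2 (C.canonicalMQCA_cls_iff.2 hP).symm, hs⟩

theorem commForm_canonicalMQCA (C : PLRMC q) (P P' Q Q' : (C.A 0).logicals)
    (hQ : C.canonicalMQCA.toEquiv (cls _ P) = cls _ Q)
    (hQ' : C.canonicalMQCA.toEquiv (cls _ P') = cls _ Q') :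
    commForm q Q Q' = commForm q P P' := by
  have h := (C.canonicalMQCA_cls_iff (P := P) (Q := Q)).1 hQ
  have h' := (C.canonicalMQCA_cls_iff (P := P') (Q := Q')).1 hQ'
  have h'' := C.commForm_evolution C.T le_rfl h h'
  exact h''

theorem exists_int_hasIndex (C : PLRMC q) : ∃ n : ℤ, C.canonicalMQCA.HasIndex n :=
  C.canonicalMQCA.exists_int_hasIndex C.base_locallyGenerated C.inverseMQCA rfl
    C.commForm_canonicalMQCA

end PLRMC

/-! ## Translation of the Majorana chain -/

section Majorana

/-- The translation of the sites of the chain with one qubit per site. -/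
def siteShift (n : ℤ) : (Σ _ : ℤ, Fin 1) ≃ Σ _ : ℤ, Fin 1 where
  toFun i := ⟨i.1 + n, i.2⟩
  invFun i := ⟨i.1 - n, i.2⟩
  left_inv i := by simp
  right_inv i := by simp

/-- The translation of Pauli operators on the chain with one qubit per site. -/
def pauliTranslate (n : ℤ) : Pauli (fun _ => 1) ≃ₗ[ZMod 2] Pauli fun _ => 1 :=
  (Finsupp.domLCongr (siteShift n) :
    ((Σ _ : ℤ, Fin 1) →₀ (ZMod 2 × ZMod 2)) ≃ₗ[ZMod 2] _)

theorem pauliTranslate_apply (n : ℤ) (P : Pauli fun _ => 1) (k : ℤ) (i : Fin 1) :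
    pauliTranslate n P ⟨k, i⟩ = P ⟨k - n, i⟩ := rfl

theorem pauliTranslate_single (n : ℤ) (j : ℤ) (i : Fin 1) (p : ZMod 2 × ZMod 2) :
    pauliTranslate n (Pauli.single ⟨j, i⟩ p) = Pauli.single ⟨j + n, i⟩ p :=
  Finsupp.domLCongr_single _ _ _

theorem pauliTranslate_majoranaGen (n j : ℤ) : pauliTranslate n (majoranaGen j) = majoranaGen (j + n) := by
  rw [majoranaGen, map_add, pauliTranslate_single, pauliTranslate_single, majoranaGen, add_right_comm]

theorem map_translate_majoranaChain (n : ℤ) :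
    majoranaChain.map (pauliTranslate n : Pauli (fun _ => 1) →ₗ[ZMod 2] _) = majoranaChain := by
  rw [majoranaChain, Submodule.map_span, ← Set.range_comp]
  congr 1
  have : (pauliTranslate n : Pauli (fun _ => 1) →ₗ[ZMod 2] _) ∘ majoranaGen =
      majoranaGen ∘ Equiv.addRight n := funext fun j => pauliTranslate_majoranaGen n j
  rw [this, (Equiv.addRight n).surjective.range_comp]

/-- The translation of the Majorana chain algebra. -/
def majoranaTranslate (n : ℤ) : majoranaChain ≃ₗ[ZMod 2] majoranaChain :=
  (pauliTranslate n).ofSubmodules _ _ (map_translate_majoranaChain n)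

theorem majoranaTranslate_coe (n : ℤ) (P : majoranaChain) :
    (majoranaTranslate n P).1 = pauliTranslate n P.1 := rfl

theorem majoranaTranslate_neg (n : ℤ) (P : majoranaChain) :
    majoranaTranslate n (majoranaTranslate (-n) P) = P := by
  refine Subtype.ext (Pauli.ext fun ⟨k, i⟩ => ?_)
  rw [majoranaTranslate_coe, pauliTranslate_apply, majoranaTranslate_coe, pauliTranslate_apply]
  simp

theorem map_majoranaTranslate_bot (n : ℤ) :
    ((⊥ : Submodule (ZMod 2) (Pauli fun _ => 1)).submoduleOf majoranaChain).map
      (majoranaTranslate n : majoranaChain →ₗ[ZMod 2] _) =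
      (⊥ : Submodule (ZMod 2) (Pauli fun _ => 1)).submoduleOf majoranaChain := by
  have : (⊥ : Submodule (ZMod 2) (Pauli fun _ => 1)).submoduleOf majoranaChain = ⊥ :=
    (Submodule.ker_subtype majoranaChain)
  rw [this, Submodule.map_bot]

/-- The translation of the Majorana chain as an automaton. -/
def majoranaMQCA (n : ℤ) : MQCA majoranaChain ⊥ where
  toEquiv := Submodule.Quotient.equiv _ _ (majoranaTranslate n) (map_majoranaTranslate_bot n)
  finite_range := by
    refine ⟨n.natAbs, fun P => ⟨majoranaTranslate n P, rfl, fun k hk => ⟨k - n, hk, ?_⟩⟩⟩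
    rw [sub_sub_cancel, Int.abs_eq_natAbs]

theorem majoranaMQCA_cls (n : ℤ) (P : majoranaChain) :
    (majoranaMQCA n).toEquiv (cls ⊥ P) = cls ⊥ (majoranaTranslate n P) := rfl

theorem majoranaMQCA_neg (n : ℤ) :
    (majoranaMQCA (-n)).toEquiv = (majoranaMQCA n).toEquiv.symm := by
  ext x
  obtain ⟨P, rfl⟩ := Submodule.mkQ_surjective _ x
  rw [LinearEquiv.eq_symm_apply]
  change (majoranaMQCA n).toEquiv ((majoranaMQCA (-n)).toEquiv (cls ⊥ P)) = cls ⊥ P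
  rw [majoranaMQCA_cls, majoranaMQCA_cls, majoranaTranslate_neg]

theorem majoranaMQCA_map_FLeft (a n : ℤ) :
    (FLeft majoranaChain ⊥ a).map (majoranaMQCA n).bar = FLeft majoranaChain ⊥ (a + n) := by
  refine le_antisymm ?_ fun x hx => ?_
  · rintro _ ⟨x, hx, rfl⟩
    obtain ⟨P, hP, rfl⟩ := exists_of_mem_FLeft hx
    rw [(majoranaMQCA n).bar_toF (majoranaMQCA_cls n P)]
    refine toF_mem_FLeft fun k hk => ?_
    have : k - n < a := hP hk
    rw [Set.mem_Iio]
    omega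
  · obtain ⟨P, hP, rfl⟩ := exists_of_mem_FLeft hx
    refine ⟨toF _ _ (majoranaTranslate (-n) P), toF_mem_FLeft fun k hk => ?_, ?_⟩
    · have : k - -n < a + n := hP hk
      rw [Set.mem_Iio]
      omega
    · rw [(majoranaMQCA n).bar_toF (majoranaMQCA_cls n _), majoranaTranslate_neg]

theorem cls_bot_injective {L : Submodule (ZMod 2) (Pauli q)} :
    Function.Injective (cls (L := L) ⊥) := fun _ _ h =>
  Subtype.ext (sub_eq_zero.1 (cls_eq_cls.1 h))

/-- Without stabilizers, there are no nontrivial classes at infinity. -/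
theorem toF_bot_injective {L : Submodule (ZMod 2) (Pauli q)} :
    Function.Injective (toF L ⊥) := by
  -- With trivial stabilizers a class has a single representative, which must vanish at every site
  -- missed by some region.
  have key : ∀ (R : ℤ → Set ℤ), (∀ k, ∃ m, k ∉ R m) →
      ⨅ k, quotOn L ⊥ (R k) = ⊥ := by
    intro R hR
    rw [eq_bot_iff]
    intro x hx
    obtain ⟨P, rfl⟩ := Submodule.mkQ_surjective _ x
    have hP : P = 0 := by
      refine Subtype.ext (Pauli.ext fun i => ?_)
      obtain ⟨m, hm⟩ := hR i.1
      obtain ⟨Q, hQ, hPQ⟩ := mem_quotOn.1 ((Submodule.mem_iInf _).1 hx m)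
      rw [← cls_bot_injective hPQ]
      exact apply_eq_zero_of_mem_pauliOn (P := Q.1) hQ hm
    rw [hP, map_zero]
    exact zero_mem _
  have h : quotNegInf L ⊥ ⊔ quotPosInf L ⊥ = ⊥ := by
    rw [quotNegInf, quotPosInf, key _ fun k => ⟨k, by simp⟩, key _ fun k => ⟨k, by simp⟩, sup_bot_eq]
  rw [injective_iff_map_eq_zero]
  intro P hP
  rw [toF_eq_zero_iff, h, Submodule.mem_bot] at hP
  exact cls_bot_injective (hP.trans (map_zero _).symm)

theorem majoranaGen_apply_fst (j k : ℤ) :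
    (majoranaGen j ⟨k, 0⟩).1 = if j = k then 1 else 0 := by
  rw [majoranaGen, Pauli.add_apply, Pauli.single, Pauli.single]
  change ((Finsupp.single (_ : Σ _ : ℤ, Fin 1) _ : _ →₀ ZMod 2 × ZMod 2) _ +
    (Finsupp.single (_ : Σ _ : ℤ, Fin 1) _ : _ →₀ ZMod 2 × ZMod 2) _).1 = _
  rw [Finsupp.single_apply, Finsupp.single_apply]
  split_ifs <;> simp_all

theorem majoranaGen_apply_snd (j k : ℤ) :
    (majoranaGen j ⟨k, 0⟩).2 = if j + 1 = k then 1 else 0 := by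
  rw [majoranaGen, Pauli.add_apply, Pauli.single, Pauli.single]
  change ((Finsupp.single (_ : Σ _ : ℤ, Fin 1) _ : _ →₀ ZMod 2 × ZMod 2) _ +
    (Finsupp.single (_ : Σ _ : ℤ, Fin 1) _ : _ →₀ ZMod 2 × ZMod 2) _).2 = _
  rw [Finsupp.single_apply, Finsupp.single_apply]
  split_ifs <;> simp_all

/-- The exponents of `X` and `Z` of an element of the Majorana chain at neighboring sites agree. -/
theorem majoranaChain_apply {P : Pauli fun _ => 1} (hP : P ∈ majoranaChain) (k : ℤ) :
    (P ⟨k, 0⟩).1 = (P ⟨k + 1, 0⟩).2 := by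
  refine Submodule.span_induction (p := fun P _ => (P ⟨k, 0⟩).1 = (P ⟨k + 1, 0⟩).2)
    ?_ rfl ?_ ?_ hP
  · rintro _ ⟨j, rfl⟩
    rw [majoranaGen_apply_fst, majoranaGen_apply_snd]
    simp
  · intro P Q _ _ h h'
    rw [Pauli.add_apply, Pauli.add_apply, Prod.fst_add, Prod.snd_add, h, h']
  · intro c P _ h
    rw [Pauli.smul_apply, Pauli.smul_apply, Prod.smul_fst, Prod.smul_snd, h]

theorem siteSupport_majoranaGen_subset (j : ℤ) :
    siteSupport (majoranaGen j) ⊆ Set.Icc j (j + 1) := by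
  rintro k ⟨i, hi⟩
  rw [Subsingleton.elim i 0] at hi
  by_contra hk
  rw [Set.mem_Icc] at hk
  refine hi (Prod.ext ?_ ?_)
  · rw [majoranaGen_apply_fst, if_neg (by omega)]
    rfl
  · rw [majoranaGen_apply_snd, if_neg (by omega)]
    rfl

/-- An `X` at site `a` forces a `Z` at `a + 1`. An element supported left of `a + 1` therefore has
only its `Z` exponent at `a` as a new coordinate, and `L_{a-1}` realizes the value one. -/
theorem relDim_FLeft_majoranaChain (a : ℤ) :
    relDim (FLeft majoranaChain ⊥ a) (FLeft majoranaChain ⊥ (a + 1)) = 1 := by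
  set g : majoranaChain := ⟨majoranaGen (a - 1), majoranaGen_mem _⟩ with hg
  have hga : (g.1 ⟨a, 0⟩).2 = 1 := by
    rw [hg, majoranaGen_apply_snd, if_pos (by omega)]
  have hgF : toF _ _ g ∉ FLeft majoranaChain ⊥ a := by
    intro h
    obtain ⟨P, hP, hPg⟩ := exists_of_mem_FLeft h
    have h0 : g.1 ⟨a, 0⟩ = 0 := by
      rw [← toF_bot_injective hPg]
      exact apply_eq_zero_of_mem_pauliOn (P := P.1) hP (lt_irrefl a)
    rw [h0] at hga
    exact absurd hga (by decide)
  have hg' : toF _ _ g ∈ FLeft majoranaChain ⊥ (a + 1) := toF_mem_FLeft fun k hk => by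
    have := siteSupport_majoranaGen_subset _ hk
    rw [Set.mem_Icc] at this
    rw [Set.mem_Iio]
    omega
  have hmap : (FLeft majoranaChain ⊥ (a + 1)).map (FLeft majoranaChain ⊥ a).mkQ =
      Submodule.span (ZMod 2) {(FLeft majoranaChain ⊥ a).mkQ (toF _ _ g)} := by
    refine le_antisymm ?_ ?_
    · rintro _ ⟨x, hx, rfl⟩
      obtain ⟨P, hP, rfl⟩ := exists_of_mem_FLeft hx
      refine Submodule.mem_span_singleton.2 ⟨(P.1 ⟨a, 0⟩).2, ?_⟩
      rw [← map_smul, ← map_smul]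
      refine (Submodule.Quotient.eq _).2 ?_
      rw [← map_sub]
      refine toF_mem_FLeft ?_
      have hmem : ∀ Q ∈ majoranaChain, siteSupport Q ⊆ Set.Iio (a + 1) → (Q ⟨a, 0⟩).2 = 0 →
          siteSupport Q ⊆ Set.Iio a := by
        rintro Q hQ hQa hQ0 k ⟨i, hi⟩
        have hka : k < a + 1 := hQa ⟨i, hi⟩
        rw [Subsingleton.elim i 0] at hi
        rcases (Int.lt_add_one_iff.1 hka).lt_or_eq with h | rfl
        · exact h
        · refine absurd (Prod.ext ?_ hQ0) hi
          rw [majoranaChain_apply hQ, apply_eq_zero_of_mem_pauliOn (P := Q) hQa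
            (i := ⟨k + 1, 0⟩) (lt_irrefl (k + 1))]
          rfl
      refine hmem _ (Subtype.mem _) ?_ ?_
      · refine Submodule.sub_mem (pauliOn _ (Set.Iio (a + 1)))
          (Submodule.smul_mem _ _ fun k hk => ?_) hP
        have := siteSupport_majoranaGen_subset _ hk
        rw [Set.mem_Icc] at this
        rw [Set.mem_Iio]
        omega
      · change (P.1 ⟨a, 0⟩).2 * (g.1 ⟨a, 0⟩).2 - (P.1 ⟨a, 0⟩).2 = 0
        rw [hga, mul_one, sub_self]
    · rw [Submodule.span_singleton_le_iff_mem]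
      exact ⟨_, hg', rfl⟩
  rw [relDim, hmap, finrank_span_singleton]
  exact fun h => hgF ((Submodule.Quotient.mk_eq_zero _).1 h)

/-- With `V = F_{<0}` and `W = F_{<1}`, the image of `V` is all of `W`, so the relative dimensions
are one and zero. -/
theorem majoranaMQCA_hasIndex : (majoranaMQCA 1).HasIndex (1 / 2) := by
  have hmap := majoranaMQCA_map_FLeft 0 1
  have hle := FLeft_mono (L := majoranaChain) (S := ⊥) (show (0 : ℤ) ≤ 0 + 1 by decide)
  have h := (majoranaMQCA 1).hasIndex_of_inverse (majoranaMQCA (-1)) (majoranaMQCA_neg 1)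
    ⟨0, 0, le_rfl, le_rfl⟩ ⟨0 + 1, 0 + 1, le_rfl, le_rfl⟩ hle hmap.le
  have h0 : relDim (FLeft majoranaChain ⊥ (0 + 1)) (FLeft majoranaChain ⊥ (0 + 1)) = 0 := by
    rw [relDim, Submodule.mkQ_map_self, finrank_bot]
  rw [hmap, relDim_FLeft_majoranaChain, h0] at h
  convert h using 1
  norm_num

end Majorana

end

theorem mainTheorem3 :
    (∀ (q : ℤ → ℕ) (C : PLRMC q), ∃ n : ℤ, C.canonicalMQCA.HasIndex (n : ℚ)) ∧
    (∃ α : MQCA majoranaChain ⊥,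
      (∀ j : ℤ, α.toEquiv (cls ⊥ ⟨majoranaGen j, majoranaGen_mem j⟩) =
        cls ⊥ ⟨majoranaGen (j + 1), majoranaGen_mem (j + 1)⟩) ∧
      α.HasIndex (1 / 2)) := by
  refine ⟨fun q C => C.exists_int_hasIndex, majoranaMQCA 1, fun j => ?_, majoranaMQCA_hasIndex⟩
  rw [majoranaMQCA_cls]
  exact congrArg _ (Subtype.ext (pauliTranslate_majoranaGen 1 j))
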